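/- Let $\Omega\subset\mathbb{R}^n$ be a bounded domain (nonempty, open, connected), and let $V\in L^\infty(\mathbb{R}^n)$ be real-valued with $\operatorname{supp}V=\overline{\Omega}$ and $V\ge\delta$ a.e. in $\Omega$ for some constant $\delta>0$. Let $$P_0(D)=\sum_{|\alpha|\le m}a_\alpha D^\alpha,\qquad a_\alpha\in\mathbb{R},\quad D_j=-i\,\partial/\partial x_j,$$ be a partial differential operator with constant real coefficients of order $m\ge 2$, with symbol $P_0(\xi)=\sum_\alpha a_\alpha\xi^\alpha$, and put $\widetilde P_0(\xi)=\bigl(\sum_{\alpha}|\partial^\alpha P_0(\xi)|^2\bigr)^{1/2}$, the sum being over all multi-indices $\alpha\in\mathbb{N}^n$. Let $H^{P_0}_0(\Omega)$ be the completion of $C_0^\infty(\Omega)$ in the norm $\|P_0(D)\varphi\|_{L^2}$, regarded as a subspace of $L^2(\Omega)$: it consists of the $L^2(\Omega)$-limits of sequences in $C_0^\infty(\Omega)$ that are Cauchy in this norm. A number $\lambda\in\mathbb{C}$ is called a transmission eigenvalue if there are $0\ne v\in L^2_{\mathrm{loc}}(\Omega)$ and $0\ne w\in L^2_{\mathrm{loc}}(\Omega)$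 such that $$(P_0-\lambda)v=0\ \text{ in }\Omega,\qquad (P_0+V-\lambda)w=0\ \text{ in }\Omega,\qquad v-w\in H^{P_0}_0(\Omega),$$ where the equations hold in the sense of distributions. Assume that $\widetilde P_0(\xi)\to\infty$ as $|\xi|\to\infty$ and that $P_0(\xi)$ or $-P_0(\xi)$ is bounded from below on $\mathbb{R}^n$. Then the set of transmission eigenvalues is a closed and discrete subset of $\mathbb{C}$, that is, it has no accumulation point in $\mathbb{C}$. -/

import Mathlib

open scoped Distributions Topology ENNReal
open MeasureTheory Filter TopologicalSpace

noncomputable section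

namespace ITP

/-- `D_j f = -i ∂f/∂x_j`. -/
def D {n : ℕ} (j : Fin n) (f : EuclideanSpace ℝ (Fin n) → ℂ) : EuclideanSpace ℝ (Fin n) → ℂ :=
  fun x => -Complex.I * fderiv ℝ f x (EuclideanSpace.single j 1)

/-- `D^α f = D_1^{α_1} ⋯ D_n^{α_n} f` for a multi-index `α`. -/
def multiD {n : ℕ} (α : Fin n → ℕ) (f : EuclideanSpace ℝ (Fin n) → ℂ) :
    EuclideanSpace ℝ (Fin n) → ℂ :=
  (List.finRange n).foldr (fun j g => (D j)^[α j] g) f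

/-- `P(D) f = ∑_α a_α D^α f` for the real polynomial `P(ξ) = ∑_α a_α ξ^α`. -/
def diffOp {n : ℕ} (P : MvPolynomial (Fin n) ℝ) (f : EuclideanSpace ℝ (Fin n) → ℂ) :
    EuclideanSpace ℝ (Fin n) → ℂ :=
  fun x => ∑ α ∈ P.support, ((P.coeff α : ℝ) : ℂ) * multiD α f x

/-- The polynomial `P(-ξ)`; `P(-D)` is the formal transpose of `P(D)`. -/
def reflect {n : ℕ} (P : MvPolynomial (Fin n) ℝ) : MvPolynomial (Fin n) ℝ :=
  MvPolynomial.aeval (fun j => -MvPolynomial.X j) P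

/-- The symbol `ξ ↦ P(ξ)` on `ℝⁿ`. -/
def symbol {n : ℕ} (P : MvPolynomial (Fin n) ℝ) (ξ : EuclideanSpace ℝ (Fin n)) : ℝ :=
  MvPolynomial.eval (fun j => ξ j) P

/-- The polynomial `∂^α P`. -/
def multiDeriv {n : ℕ} (α : Fin n → ℕ) (P : MvPolynomial (Fin n) ℝ) : MvPolynomial (Fin n) ℝ :=
  (List.finRange n).foldr (fun j Q => (MvPolynomial.pderiv j)^[α j] Q) P

/-- `P̃(ξ) = (∑_α |P^{(α)}(ξ)|²)^{1/2}`. The derivatives with some `α_j > deg P` vanish, so the sum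
over all multi-indices is the sum over those with all `α_j ≤ deg P`. -/
def symbolTilde {n : ℕ} (P : MvPolynomial (Fin n) ℝ) (ξ : EuclideanSpace ℝ (Fin n)) : ℝ :=
  Real.sqrt (∑ α : Fin n → Fin (P.totalDegree + 1),
    |symbol (multiDeriv (fun j => (α j : ℕ)) P) ξ| ^ 2)

/-- The support of (the a.e. class of) `f`: the complement of the largest open set on which
`f = 0` almost everywhere. -/
def essSupport {n : ℕ} (f : EuclideanSpace ℝ (Fin n) → ℝ) : Set (EuclideanSpace ℝ (Fin n)) :=
  {x | ∀ U ∈ 𝓝 x, ¬ f =ᵐ[volume.restrict U] 0}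

/-- `f ∈ L²_loc(Ω)`. -/
def MemL2Loc {n : ℕ} (Ω : Opens (EuclideanSpace ℝ (Fin n)))
    (f : EuclideanSpace ℝ (Fin n) → ℂ) : Prop :=
  ∀ K : Set (EuclideanSpace ℝ (Fin n)), IsCompact K → K ⊆ Ω → MemLp f 2 (volume.restrict K)

/-- `(P(D) + q) f = 0` in the sense of distributions on `Ω`, for a function `q`. -/
def WeakSolution {n : ℕ} (Ω : Opens (EuclideanSpace ℝ (Fin n))) (P : MvPolynomial (Fin n) ℝ)
    (q f : EuclideanSpace ℝ (Fin n) → ℂ) : Prop :=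
  ∀ φ : 𝓓(Ω, ℂ), ∫ x in (Ω : Set (EuclideanSpace ℝ (Fin n))),
    f x * (diffOp (reflect P) φ x + q x * φ x) = 0

/-- `u ∈ H_0^P(Ω)`, the completion of `C_0^∞(Ω)` in the norm `‖P(D)φ‖_{L²}`, whose elements are
identified with functions in `L²(Ω)`: the `L²(Ω)`-limits of sequences in `C_0^∞(Ω)` that are Cauchy
in that norm (such sequences are Cauchy in `L²` when `Ω` is bounded and `P ≠ 0`). -/
def MemH0 {n : ℕ} (Ω : Opens (EuclideanSpace ℝ (Fin n))) (P : MvPolynomial (Fin n) ℝ)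
    (u : EuclideanSpace ℝ (Fin n) → ℂ) : Prop :=
  MemLp u 2 (volume.restrict (Ω : Set (EuclideanSpace ℝ (Fin n)))) ∧
  ∃ φ : ℕ → 𝓓(Ω, ℂ),
    Tendsto (fun p : ℕ × ℕ => eLpNorm (diffOp P (φ p.1) - diffOp P (φ p.2)) 2 volume)
      atTop (𝓝 0) ∧
    Tendsto (fun k => eLpNorm (⇑(φ k) - u) 2
      (volume.restrict (Ω : Set (EuclideanSpace ℝ (Fin n))))) atTop (𝓝 0)

/-- `z` is a transmission eigenvalue: there are nonzero `v, w ∈ L²_loc(Ω)` with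
`(P(D) - z) v = 0` and `(P(D) + V - z) w = 0` in `Ω` and `v - w ∈ H_0^P(Ω)`. -/
def IsTransmissionEigenvalue {n : ℕ} (Ω : Opens (EuclideanSpace ℝ (Fin n)))
    (P : MvPolynomial (Fin n) ℝ) (V : EuclideanSpace ℝ (Fin n) → ℝ) (z : ℂ) : Prop :=
  ∃ v w : EuclideanSpace ℝ (Fin n) → ℂ,
    MemL2Loc Ω v ∧ MemL2Loc Ω w ∧
    ¬ v =ᵐ[volume.restrict (Ω : Set (EuclideanSpace ℝ (Fin n)))] 0 ∧
    ¬ w =ᵐ[volume.restrict (Ω : Set (EuclideanSpace ℝ (Fin n)))] 0 ∧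
    WeakSolution Ω P (fun _ => -z) v ∧
    WeakSolution Ω P (fun x => (V x : ℂ) - z) w ∧
    MemH0 Ω P (v - w)

end ITP

end

/-!
Put `u = v - w`. On `Ω` one has `(P(D) - z) u = V w`, so for `ρ = 1 / V` the function
`ρ (P(D) - z) u + u` equals `v` and is annihilated by `P(D) - z`. Hence the sesquilinear form
`⟨(P(D) - z̄) k, ρ (P(D) - z) h + h⟩` on `H_0^P(Ω)` degenerates at `h = u`, which is nonzero because
`w` is. With `z = t + μ` the form becomes a quadratic pencil `S + μ A + μ² B`. Since `P` or `-P` is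
bounded from below and `ρ` is bounded away from `0`, it is coercive at a suitable real `z = t`, so
`S` is invertible. The operators `A` and `B` are compact because `H_0^P(Ω)` embeds compactly into
`L²`: Hörmander's inequality `‖P^{(α)}(D) φ‖ ≤ C ‖P(D) φ‖` on the bounded set `Ω` controls the norm
of `P̃(D) φ`, and `P̃ → ∞`. Linearising the pencil turns the values `μ` into reciprocals of
eigenvalues of one compact operator, of which only finitely many lie outside any disc around `0`.
-/

namespace ITP

section Eigenvalues

variable {𝕜 E : Type*} [NontriviallyNormedField 𝕜] [NormedAddCommGroup E] [NormedSpace 𝕜 E]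

theorem map_mem_span_eigenvectors {ι : Type*} {T : E →ₗ[𝕜] E} {κ : ι → 𝕜} {x : ι → E}
    (hx : ∀ i, T (x i) = κ i • x i) {s : Set ι} {y : E} (hy : y ∈ Submodule.span 𝕜 (x '' s)) :
    T y ∈ Submodule.span 𝕜 (x '' s) := by
  have hle : Submodule.span 𝕜 (x '' s) ≤ (Submodule.span 𝕜 (x '' s)).comap T := by
    rw [Submodule.span_le]
    rintro _ ⟨i, hi, rfl⟩
    rw [SetLike.mem_coe, Submodule.mem_comap, hx]
    exact Submodule.smul_mem _ _ (Submodule.subset_span ⟨i, hi, rfl⟩)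
  exact hle hy

theorem map_sub_smul_mem_span_Iio {ι : Type*} [PartialOrder ι] {T : E →ₗ[𝕜] E} {κ : ι → 𝕜}
    {x : ι → E} (hx : ∀ i, T (x i) = κ i • x i) {k : ι} {y : E}
    (hy : y ∈ Submodule.span 𝕜 (x '' Set.Iic k)) :
    T y - κ k • y ∈ Submodule.span 𝕜 (x '' Set.Iio k) := by
  have hle : Submodule.span 𝕜 (x '' Set.Iic k) ≤
      (Submodule.span 𝕜 (x '' Set.Iio k)).comap (T - κ k • LinearMap.id) := by
    rw [Submodule.span_le]
    rintro _ ⟨i, hi, rfl⟩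
    have hi' : (T - κ k • (LinearMap.id : E →ₗ[𝕜] E)) (x i) = (κ i - κ k) • x i := by
      simp [hx, sub_smul]
    rw [SetLike.mem_coe, Submodule.mem_comap, hi']
    rcases (Set.mem_Iic.1 hi).lt_or_eq with hik | rfl
    · exact Submodule.smul_mem _ _ (Submodule.subset_span ⟨i, hik, rfl⟩)
    · simp
  exact hle hy

theorem exists_bounded_seq_one_le_norm_sub [CompleteSpace 𝕜] {x : ℕ → E}
    (hx : LinearIndependent 𝕜 x) :
    ∃ (R : ℝ) (e : ℕ → E), ∀ k, ‖e k‖ ≤ R ∧ e k ∈ Submodule.span 𝕜 (x '' Set.Iic k) ∧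
      ∀ y ∈ Submodule.span 𝕜 (x '' Set.Iio k), 1 ≤ ‖e k - y‖ := by
  obtain ⟨c, hc⟩ := NormedField.exists_one_lt_norm 𝕜
  have hriesz (k : ℕ) : ∃ e : E, ‖e‖ ≤ ‖c‖ + 1 ∧ e ∈ Submodule.span 𝕜 (x '' Set.Iic k) ∧
      ∀ y ∈ Submodule.span 𝕜 (x '' Set.Iio k), 1 ≤ ‖e - y‖ := by
    have hmono : Submodule.span 𝕜 (x '' Set.Iio k) ≤ Submodule.span 𝕜 (x '' Set.Iic k) :=
      Submodule.span_mono (Set.image_mono Set.Iio_subset_Iic_self)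
    have hclosed : IsClosed (Submodule.span 𝕜 (x '' Set.Iio k) : Set E) :=
      have := FiniteDimensional.span_of_finite 𝕜 ((Set.finite_Iio k).image x)
      Submodule.closed_of_finiteDimensional _
    obtain ⟨e, heR, he⟩ := riesz_lemma_of_norm_lt hc (lt_add_one ‖c‖)
      (F := (Submodule.span 𝕜 (x '' Set.Iio k)).comap (Submodule.span 𝕜 (x '' Set.Iic k)).subtype)
      (hclosed.preimage continuous_subtype_val)
      ⟨⟨x k, Submodule.subset_span ⟨k, Set.self_mem_Iic, rfl⟩⟩,
        hx.notMem_span_image Set.self_notMem_Iio⟩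
    exact ⟨e, heR, e.2, fun y hy => he ⟨y, hmono hy⟩ hy⟩
  choose e he using hriesz
  exact ⟨_, e, he⟩

theorem norm_eigenvalue_le_norm_map_sub_map {T : E →ₗ[𝕜] E} {κ : ℕ → 𝕜} {x e : ℕ → E}
    (hx : ∀ k, T (x k) = κ k • x k) (he : ∀ k, e k ∈ Submodule.span 𝕜 (x '' Set.Iic k))
    (hsep : ∀ k, ∀ y ∈ Submodule.span 𝕜 (x '' Set.Iio k), 1 ≤ ‖e k - y‖) {i k : ℕ}
    (hik : i < k) : ‖κ k‖ ≤ ‖T (e k) - T (e i)‖ := by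
  rcases eq_or_ne (κ k) 0 with hκ | hκ
  · simp [hκ]
  have hei : T (e i) ∈ Submodule.span 𝕜 (x '' Set.Iio k) := map_mem_span_eigenvectors hx <|
    Submodule.span_mono (Set.image_mono fun l (hl : l ≤ i) => hl.trans_lt hik) (he i)
  set y := (κ k)⁻¹ • (T (e i) - (T (e k) - κ k • e k)) with hy
  have hy_mem : y ∈ Submodule.span 𝕜 (x '' Set.Iio k) :=
    Submodule.smul_mem _ _ (Submodule.sub_mem _ hei (map_sub_smul_mem_span_Iio hx (he k)))
  have hdiff : T (e k) - T (e i) = κ k • (e k - y) := by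
    rw [hy, smul_sub, smul_inv_smul₀ hκ]
    abel
  rw [hdiff, norm_smul]
  exact le_mul_of_one_le_right (norm_nonneg _) (hsep k y hy_mem)

theorem finite_eigenvalues_of_isCompactOperator [CompleteSpace 𝕜] {T : E →L[𝕜] E}
    (hT : IsCompactOperator T) {r : ℝ} (hr : 0 < r) :
    {κ : 𝕜 | r ≤ ‖κ‖ ∧ ∃ x : E, x ≠ 0 ∧ T x = κ • x}.Finite := by
  by_contra hinf
  obtain ⟨κ, hκ⟩ : ∃ κ : ℕ ↪ 𝕜, ∀ k, r ≤ ‖κ k‖ ∧ ∃ x : E, x ≠ 0 ∧ T x = κ k • x :=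
    ⟨(Set.Infinite.natEmbedding _ hinf).trans (Function.Embedding.subtype _),
      fun k => (Set.Infinite.natEmbedding _ hinf k).2⟩
  choose hκr x hx0 hx using hκ
  have hlin : LinearIndependent 𝕜 x :=
    Module.End.eigenvectors_linearIndependent' (T : E →ₗ[𝕜] E) κ κ.injective x fun k =>
      ⟨Module.End.mem_eigenspace_iff.2 (hx k), hx0 k⟩
  obtain ⟨R, e, he⟩ := exists_bounded_seq_one_le_norm_sub hlin
  obtain ⟨K, hK, hTK⟩ := hT.image_closedBall_subset_compact (f := (T : E →ₗ[𝕜] E)) R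
  obtain ⟨a, -, φ, hφ, hlim⟩ := hK.tendsto_subseq (x := fun k => T (e k)) fun k =>
    hTK ⟨e k, mem_closedBall_zero_iff.2 (he k).1, rfl⟩
  obtain ⟨N, hN⟩ := Metric.cauchySeq_iff.1 hlim.cauchySeq r hr
  have hclose : ‖T (e (φ (N + 1))) - T (e (φ N))‖ < r :=
    dist_eq_norm (T (e (φ (N + 1)))) _ ▸ hN (N + 1) N.le_succ N le_rfl
  have hfar : ‖κ (φ (N + 1))‖ ≤ ‖T (e (φ (N + 1))) - T (e (φ N))‖ :=
    norm_eigenvalue_le_norm_map_sub_map (T := (T : E →ₗ[𝕜] E)) hx (fun k => (he k).2.1)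
      (fun k => (he k).2.2) (hφ N.lt_succ_self)
  linarith [hκr (φ (N + 1))]

end Eigenvalues

section Compactness

theorem exists_finite_net_image_closedBall {𝕜 E F G : Type*} [NontriviallyNormedField 𝕜]
    [NormedAddCommGroup E] [NormedSpace 𝕜 E] [NormedAddCommGroup F] [NormedSpace 𝕜 F]
    [NormedAddCommGroup G] [NormedSpace 𝕜 G] {S : E →L[𝕜] G} (hS : IsCompactOperator S)
    {T : E →L[𝕜] F} {δ ε : ℝ} (hδ : 0 < δ) (h : ∀ x, ‖x‖ ≤ 2 → ‖S x‖ < δ → ‖T x‖ < ε) :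
    ∃ t : Set F, t.Finite ∧ T '' Metric.closedBall 0 1 ⊆ ⋃ y ∈ t, Metric.ball y ε := by
  have htb : TotallyBounded (S '' Metric.closedBall 0 1) :=
    (hS.isCompact_closure_image_closedBall (f := (S : E →ₗ[𝕜] G)) 1).totallyBounded.subset
      subset_closure
  obtain ⟨t, hts, htf, hcov⟩ := Metric.finite_approx_of_totallyBounded htb δ hδ
  choose! g hg hSg using fun y (hy : y ∈ t) => hts hy
  refine ⟨(fun y => T (g y)) '' t, htf.image _, ?_⟩
  rintro _ ⟨x, hx, rfl⟩
  obtain ⟨y, hy, hxy⟩ := Set.mem_iUnion₂.1 (hcov ⟨x, hx, rfl⟩)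
  have hxg : ‖x - g y‖ ≤ 2 := by
    have := mem_closedBall_zero_iff.1 hx
    have := mem_closedBall_zero_iff.1 (hg y hy)
    linarith [norm_sub_le x (g y)]
  have hSxg : ‖S (x - g y)‖ < δ := by rwa [map_sub, hSg y hy, ← dist_eq_norm]
  refine Set.mem_iUnion₂.2 ⟨T (g y), ⟨y, hy, rfl⟩, ?_⟩
  rw [Metric.mem_ball, dist_eq_norm, ← map_sub]
  exact h _ hxg hSxg

theorem isCompactOperator_of_forall_finite_net {𝕜 E F : Type*} [NontriviallyNormedField 𝕜]
    [NormedAddCommGroup E] [NormedSpace 𝕜 E] [NormedAddCommGroup F] [NormedSpace 𝕜 F]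
    [CompleteSpace F] {T : E →L[𝕜] F} (h : ∀ ε > 0, ∃ t : Set F, t.Finite ∧
      T '' Metric.closedBall 0 1 ⊆ ⋃ y ∈ t, Metric.ball y ε) : IsCompactOperator T :=
  (isCompactOperator_iff_isCompact_closure_image_closedBall (T : E →ₗ[𝕜] F) zero_lt_one).2 <|
    (Metric.totallyBounded_iff.2 h).closure.isCompact_of_isClosed isClosed_closure

theorem isCompactOperator_of_forall_norm_le {𝕜 E F : Type*} [NontriviallyNormedField 𝕜]
    [LocallyCompactSpace 𝕜] [NormedAddCommGroup E] [NormedSpace 𝕜 E] [NormedAddCommGroup F]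
    [NormedSpace 𝕜 F] [CompleteSpace F] (T : E →L[𝕜] F)
    (h : ∀ ε > 0, ∃ (N : ℕ) (l : E →L[𝕜] (Fin N → 𝕜)), ∀ x, ‖T x‖ ≤ ε * ‖x‖ + ‖l x‖) :
    IsCompactOperator T := by
  refine isCompactOperator_of_forall_finite_net fun ε hε => ?_
  obtain ⟨N, l, hl⟩ := h (ε / 4) (by positivity)
  refine exists_finite_net_image_closedBall (isCompactOperator_of_locallyCompactSpace_dom l)
    (half_pos hε) fun x hx hlx => ?_
  nlinarith [hl x]

theorem isCompactOperator_adjoint {𝕜 E F : Type*} [RCLike 𝕜] [NormedAddCommGroup E]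
    [InnerProductSpace 𝕜 E] [CompleteSpace E] [NormedAddCommGroup F] [InnerProductSpace 𝕜 F]
    [CompleteSpace F] {T : E →L[𝕜] F} (hT : IsCompactOperator T) :
    IsCompactOperator (ContinuousLinearMap.adjoint T) := by
  set S := ContinuousLinearMap.adjoint T with hS
  refine isCompactOperator_of_forall_finite_net fun ε hε => ?_
  refine exists_finite_net_image_closedBall (S := T ∘L S) (hT.comp_clm S)
    (δ := ε ^ 2 / 2) (by positivity) fun x hx hTSx => ?_
  have hsq : ‖S x‖ ^ 2 ≤ ‖x‖ * ‖T (S x)‖ := by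
    rw [← inner_self_eq_norm_sq (𝕜 := 𝕜), hS, ContinuousLinearMap.adjoint_inner_left]
    exact re_inner_le_norm _ _
  have hlt : ‖T (S x)‖ < ε ^ 2 / 2 := hTSx
  nlinarith [norm_nonneg (S x), norm_nonneg (T (S x))]

end Compactness

theorem isClosed_and_isDiscrete_of_finite_inter_closedBall {X : Type*} [MetricSpace X] (a : X)
    {s : Set X} (h : ∀ R, (s ∩ Metric.closedBall a R).Finite) : IsClosed s ∧ IsDiscrete s := by
  rw [isClosed_and_discrete_iff]
  intro x
  have hx : ((s ∩ Metric.closedBall a (dist x a + 1)) \ {x})ᶜ ∈ 𝓝 x :=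
    (h _).sdiff.isClosed.isOpen_compl.mem_nhds (by simp)
  rw [Filter.disjoint_principal_right, mem_nhdsWithin_iff_eventually]
  filter_upwards [hx, Metric.ball_mem_nhds x one_pos] with z hz hzx hne hzs
  refine hz ⟨⟨hzs, ?_⟩, hne⟩
  rw [Metric.mem_closedBall]
  linarith [dist_triangle z x a, Metric.mem_ball.1 hzx]

section Pencil

variable {𝕜 H L : Type*} [NontriviallyNormedField 𝕜] [NormedAddCommGroup H] [NormedSpace 𝕜 H]
  [NormedAddCommGroup L] [NormedSpace 𝕜 L]

theorem isCompactOperator_prod {E : Type*} [NormedAddCommGroup E] [NormedSpace 𝕜 E]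
    {f : E →L[𝕜] H} {g : E →L[𝕜] L} (hf : IsCompactOperator f) (hg : IsCompactOperator g) :
    IsCompactOperator (f.prod g) := by
  have heq : (f.prod g : E → H × L) =
      ContinuousLinearMap.inl 𝕜 H L ∘ f + ContinuousLinearMap.inr 𝕜 H L ∘ g := by
    funext x
    simp
  rw [heq]
  exact (hf.clm_comp (ContinuousLinearMap.inl 𝕜 H L)).add
    (hg.clm_comp (ContinuousLinearMap.inr 𝕜 H L))

-- `(h, μ j h)` is an eigenvector with eigenvalue `μ⁻¹` of the compact companion operator
-- `(x, y) ↦ (-S⁻¹ A x - S⁻¹ B y, j x)`.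
theorem finite_singular_of_quadratic_pencil [CompleteSpace 𝕜] {S A : H →L[𝕜] H} {B : L →L[𝕜] H}
    {j : H →L[𝕜] L} (hS : IsUnit S) (hA : IsCompactOperator A) (hB : IsCompactOperator B)
    (hj : IsCompactOperator j) (R : ℝ) :
    {μ : 𝕜 | ‖μ‖ ≤ R ∧ ∃ h : H, h ≠ 0 ∧ S h + μ • A h + μ ^ 2 • B (j h) = 0}.Finite := by
  obtain ⟨Q, hQS⟩ : ∃ Q : H →L[𝕜] H, ∀ h, Q (S h) = h :=
    ⟨hS.unit⁻¹.1, fun h => DFunLike.congr_fun hS.val_inv_mul h⟩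
  set M : H × L →L[𝕜] H × L :=
    (-(Q ∘L A) ∘L ContinuousLinearMap.fst 𝕜 H L - (Q ∘L B) ∘L ContinuousLinearMap.snd 𝕜 H L).prod
      (j ∘L ContinuousLinearMap.fst 𝕜 H L) with hM_def
  have hM : IsCompactOperator M := isCompactOperator_prod
    (((hA.clm_comp Q).neg.comp_clm (ContinuousLinearMap.fst 𝕜 H L)).sub
      ((hB.clm_comp Q).comp_clm (ContinuousLinearMap.snd 𝕜 H L)))
    (hj.comp_clm (ContinuousLinearMap.fst 𝕜 H L))
  have hfin := finite_eigenvalues_of_isCompactOperator hM (r := (max R 1)⁻¹) (by positivity)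
  refine ((hfin.image (·⁻¹)).insert 0).subset ?_
  rintro μ ⟨hμR, h, hh, hpencil⟩
  rcases eq_or_ne μ 0 with rfl | hμ
  · exact Set.mem_insert _ _
  refine Set.mem_insert_of_mem _ ⟨μ⁻¹, ⟨?_, (h, μ • j h), ?_, ?_⟩, inv_inv μ⟩
  · rw [norm_inv]
    exact inv_anti₀ (norm_pos_iff.2 hμ) (hμR.trans (le_max_left _ _))
  · exact fun h0 => hh (congrArg Prod.fst h0)
  · have hfst : -Q (A h) - μ • Q (B (j h)) = μ⁻¹ • h := by
      have hQ := congrArg Q hpencil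
      simp only [map_add, map_smul, map_zero, hQS] at hQ
      rw [eq_inv_smul_iff₀ hμ, ← sub_eq_zero, ← neg_eq_zero, ← hQ]
      module
    have hsnd : j h = μ⁻¹ • μ • j h := (inv_smul_smul₀ hμ _).symm
    exact Prod.ext (by simpa [hM_def] using hfst) (by simpa [hM_def] using hsnd)

end Pencil

section TransmissionForm

open scoped ComplexConjugate

variable {𝕜 H L : Type*} [RCLike 𝕜] [NormedAddCommGroup H] [InnerProductSpace 𝕜 H]
  [NormedAddCommGroup L] [InnerProductSpace 𝕜 L]

/-- The sesquilinear form of the transmission problem, for an abstract operator `p` in the role of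
`P(D)`, an embedding `j` into the pivot space, and `ρ` in the role of multiplication by `1 / V`. -/
noncomputable def transmissionForm (p j : H →L[𝕜] L) (ρ : L →L[𝕜] L) (z : 𝕜) (k h : H) : 𝕜 :=
  inner 𝕜 (p k - conj z • j k) (ρ (p h - z • j h) + j h)

theorem re_inner_sub_ofReal_smul_self (u v : L) (t : ℝ) :
    RCLike.re (inner 𝕜 (u - (t : 𝕜) • v) v) = RCLike.re (inner 𝕜 u v) - t * ‖v‖ ^ 2 := by
  rw [inner_sub_left, inner_smul_left, RCLike.conj_ofReal, map_sub, RCLike.re_ofReal_mul,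
    inner_self_eq_norm_sq]

theorem coercive_of_le_re_inner {ρ : L →L[𝕜] L} {c C : ℝ} (hc : 0 ≤ c)
    (hρ : ∀ f, c * ‖f‖ ^ 2 ≤ RCLike.re (inner 𝕜 f (ρ f))) {f u v : L}
    (hf : f = u - ((C - 1 : ℝ) : 𝕜) • v) (huv : C * ‖v‖ ^ 2 ≤ RCLike.re (inner 𝕜 u v)) :
    c / 2 * ‖f‖ ^ 2 + ‖v‖ ^ 2 ≤ RCLike.re (inner 𝕜 f (ρ f + v)) := by
  have hv : RCLike.re (inner 𝕜 f v) = RCLike.re (inner 𝕜 u v) - (C - 1) * ‖v‖ ^ 2 :=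
    hf ▸ re_inner_sub_ofReal_smul_self u v _
  rw [inner_add_right, map_add, hv]
  nlinarith [hρ f, sq_nonneg ‖f‖]

theorem coercive_of_re_inner_le {ρ : L →L[𝕜] L} {c C : ℝ} (hc : 0 < c)
    (hρ : ∀ f, c * ‖f‖ ^ 2 ≤ RCLike.re (inner 𝕜 f (ρ f))) {f u v : L}
    (hf : f = u - ((C + 2 / c + 1 : ℝ) : 𝕜) • v) (huv : RCLike.re (inner 𝕜 u v) ≤ C * ‖v‖ ^ 2) :
    c / 2 * ‖f‖ ^ 2 + ‖v‖ ^ 2 ≤ RCLike.re (inner 𝕜 f (ρ f + v)) := by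
  have hneg : (2 / c + 1) * ‖v‖ ^ 2 ≤ -RCLike.re (inner 𝕜 f v) := by
    rw [hf, re_inner_sub_ofReal_smul_self]
    linarith
  have hCS : -RCLike.re (inner 𝕜 f v) ≤ ‖f‖ * ‖v‖ := by
    have := re_inner_le_norm (𝕜 := 𝕜) (-f) v
    rwa [inner_neg_left, map_neg, norm_neg] at this
  have hyoung : 2 * (‖f‖ * ‖v‖) ≤ c / 2 * ‖f‖ ^ 2 + 2 / c * ‖v‖ ^ 2 := by
    have hsq : c / 2 * ‖f‖ ^ 2 + 2 / c * ‖v‖ ^ 2 - 2 * (‖f‖ * ‖v‖) =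
        2 / c * (c / 2 * ‖f‖ - ‖v‖) ^ 2 := by field
    have : 0 ≤ 2 / c * (c / 2 * ‖f‖ - ‖v‖) ^ 2 := by positivity
    linarith
  rw [inner_add_right, map_add]
  linarith [hρ f]

theorem min_mul_graph_norm_sq_le {c : ℝ} (hc : 0 ≤ c) (t : ℝ) (u v : L) :
    min (c / 4) (1 / (2 * t ^ 2 + 1)) * (‖v‖ ^ 2 + ‖u‖ ^ 2) ≤
      c / 2 * ‖u - (t : 𝕜) • v‖ ^ 2 + ‖v‖ ^ 2 := by
  set a := min (c / 4) (1 / (2 * t ^ 2 + 1))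
  set f := u - (t : 𝕜) • v with hf
  have ha_le : a ≤ c / 4 := min_le_left _ _
  have ha_mul_le : a * (2 * t ^ 2 + 1) ≤ 1 := by
    rw [← le_div_iff₀ (by positivity)]
    exact min_le_right _ _
  have hu : ‖u‖ ^ 2 ≤ 2 * ‖f‖ ^ 2 + 2 * t ^ 2 * ‖v‖ ^ 2 := calc
    ‖u‖ ^ 2 = ‖f + (t : 𝕜) • v‖ ^ 2 := by rw [hf, sub_add_cancel]
    _ ≤ (‖f‖ + |t| * ‖v‖) ^ 2 := by
      gcongr
      exact (norm_add_le _ _).trans_eq (by rw [norm_smul, RCLike.norm_ofReal])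
    _ ≤ 2 * (‖f‖ ^ 2 + (|t| * ‖v‖) ^ 2) := add_sq_le
    _ = 2 * ‖f‖ ^ 2 + 2 * t ^ 2 * ‖v‖ ^ 2 := by rw [mul_pow, sq_abs]; ring
  calc a * (‖v‖ ^ 2 + ‖u‖ ^ 2)
      ≤ a * (‖v‖ ^ 2 + (2 * ‖f‖ ^ 2 + 2 * t ^ 2 * ‖v‖ ^ 2)) := by gcongr
    _ = 2 * a * ‖f‖ ^ 2 + a * (2 * t ^ 2 + 1) * ‖v‖ ^ 2 := by ring
    _ ≤ 2 * (c / 4) * ‖f‖ ^ 2 + 1 * ‖v‖ ^ 2 := by gcongr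
    _ = c / 2 * ‖f‖ ^ 2 + ‖v‖ ^ 2 := by ring

theorem exists_coercive_transmissionForm {p j : H →L[𝕜] L} {ρ : L →L[𝕜] L} {c : ℝ} (hc : 0 < c)
    (hgraph : ∀ h, ‖h‖ ^ 2 ≤ ‖j h‖ ^ 2 + ‖p h‖ ^ 2)
    (hρ : ∀ f, c * ‖f‖ ^ 2 ≤ RCLike.re (inner 𝕜 f (ρ f)))
    (hsemi : (∃ C : ℝ, ∀ h, C * ‖j h‖ ^ 2 ≤ RCLike.re (inner 𝕜 (p h) (j h))) ∨
      ∃ C : ℝ, ∀ h, RCLike.re (inner 𝕜 (p h) (j h)) ≤ C * ‖j h‖ ^ 2) :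
    ∃ t a : ℝ, 0 < a ∧ ∀ h, a * ‖h‖ ^ 2 ≤ RCLike.re (transmissionForm p j ρ (t : 𝕜) h h) := by
  suffices h : ∃ t : ℝ, ∀ h, c / 2 * ‖p h - (t : 𝕜) • j h‖ ^ 2 + ‖j h‖ ^ 2 ≤
      RCLike.re (inner 𝕜 (p h - (t : 𝕜) • j h) (ρ (p h - (t : 𝕜) • j h) + j h)) by
    obtain ⟨t, ht⟩ := h
    refine ⟨t, min (c / 4) (1 / (2 * t ^ 2 + 1)), by positivity, fun h => ?_⟩
    rw [transmissionForm, RCLike.conj_ofReal]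
    refine le_trans ?_ ((min_mul_graph_norm_sq_le hc.le t (p h) (j h)).trans (ht h))
    gcongr
    exact hgraph h
  rcases hsemi with ⟨C, hC⟩ | ⟨C, hC⟩
  · exact ⟨C - 1, fun h => coercive_of_le_re_inner hc.le hρ rfl (hC h)⟩
  · exact ⟨C + 2 / c + 1, fun h => coercive_of_re_inner_le hc hρ rfl (hC h)⟩

theorem transmissionForm_ofReal_add (p j : H →L[𝕜] L) (ρ : L →L[𝕜] L) (t : ℝ) (μ : 𝕜) (k h : H) :
    transmissionForm p j ρ (t + μ) k h = transmissionForm (p - (t : 𝕜) • j) j ρ μ k h := by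
  simp only [transmissionForm, sub_apply, smul_apply,
    map_add, RCLike.conj_ofReal, add_smul, sub_add_eq_sub_sub]

open scoped InnerProduct in
theorem transmissionForm_eq_inner_pencil [CompleteSpace H] [CompleteSpace L] (p j : H →L[𝕜] L)
    (ρ : L →L[𝕜] L) (μ : 𝕜) (k h : H) :
    transmissionForm p j ρ μ k h = inner 𝕜 k ((p† ∘L (ρ ∘L p + j)) h +
      μ • (-(j† ∘L (ρ ∘L p + j) + (p† ∘L ρ) ∘L j)) h + μ ^ 2 • (j† ∘L ρ) (j h)) := by
  simp only [transmissionForm, ContinuousLinearMap.comp_apply, add_apply,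
    neg_apply, inner_add_right, inner_neg_right, inner_sub_left,
    inner_sub_right, inner_smul_left, inner_smul_right, ContinuousLinearMap.adjoint_inner_right,
    map_sub, map_smul, RCLike.conj_conj]
  ring

open scoped InnerProduct in
theorem finite_degenerate_transmissionForm [CompleteSpace H] [CompleteSpace L]
    {p j : H →L[𝕜] L} {ρ : L →L[𝕜] L} {c : ℝ} (hc : 0 < c)
    (hj : IsCompactOperator j) (hgraph : ∀ h, ‖h‖ ^ 2 ≤ ‖j h‖ ^ 2 + ‖p h‖ ^ 2)
    (hρ : ∀ f, c * ‖f‖ ^ 2 ≤ RCLike.re (inner 𝕜 f (ρ f)))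
    (hsemi : (∃ C : ℝ, ∀ h, C * ‖j h‖ ^ 2 ≤ RCLike.re (inner 𝕜 (p h) (j h))) ∨
      ∃ C : ℝ, ∀ h, RCLike.re (inner 𝕜 (p h) (j h)) ≤ C * ‖j h‖ ^ 2) (R : ℝ) :
    {z : 𝕜 | ‖z‖ ≤ R ∧ ∃ h : H, h ≠ 0 ∧ ∀ k, transmissionForm p j ρ z k h = 0}.Finite := by
  obtain ⟨t, a, ha, hcoer⟩ := exists_coercive_transmissionForm hc hgraph hρ hsemi
  set q : H →L[𝕜] L := p - (t : 𝕜) • j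
  have hform (μ : 𝕜) (k h : H) := (transmissionForm_ofReal_add p j ρ t μ k h).trans
    (transmissionForm_eq_inner_pencil q j ρ μ k h)
  have hS : IsUnit (q† ∘L (ρ ∘L q + j)) := by
    refine ContinuousLinearMap.isUnit_of_forall_le_norm_inner_map _ (c := ⟨a, ha.le⟩) ha
      fun h => ?_
    have hh : transmissionForm p j ρ t h h = inner 𝕜 h ((q† ∘L (ρ ∘L q + j)) h) := by
      simpa using hform 0 h h
    rw [norm_inner_symm, ← hh, mul_comm]
    exact (hcoer h).trans (RCLike.re_le_norm _)
  have hj' : IsCompactOperator (j†) := isCompactOperator_adjoint hj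
  have hA : IsCompactOperator (-(j† ∘L (ρ ∘L q + j) + (q† ∘L ρ) ∘L j)) :=
    ((hj'.comp_clm (ρ ∘L q + j)).add (hj.clm_comp (q† ∘L ρ))).neg
  have hB : IsCompactOperator (j† ∘L ρ) := hj'.comp_clm ρ
  refine ((finite_singular_of_quadratic_pencil hS hA hB hj (R + |t|)).image
    fun μ => (t : 𝕜) + μ).subset ?_
  rintro z ⟨hz, h, hh, hdeg⟩
  refine ⟨z - t, ⟨?_, h, hh, ext_inner_left 𝕜 fun k => ?_⟩, add_sub_cancel _ _⟩
  · exact (norm_sub_le _ _).trans (by rw [RCLike.norm_ofReal]; gcongr)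
  · rw [inner_zero_right, ← hform, add_sub_cancel, hdeg]

end TransmissionForm

section ConstantCoefficient

open SchwartzMap FourierTransform LineDeriv MvPolynomial
open scoped SchwartzMap Real

variable {n : ℕ}

local notation "ℝⁿ" => EuclideanSpace ℝ (Fin n)

@[fun_prop]
theorem hasTemperateGrowth_coord (j : Fin n) :
    Function.HasTemperateGrowth fun x : ℝⁿ => x j :=
  (EuclideanSpace.proj (𝕜 := ℝ) j).hasTemperateGrowth

@[fun_prop]
theorem hasTemperateGrowth_symbol (Q : MvPolynomial (Fin n) ℝ) :
    Function.HasTemperateGrowth (symbol Q) := by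
  induction Q using MvPolynomial.induction_on with
  | C a =>
    have hC : symbol (C a : MvPolynomial (Fin n) ℝ) = fun _ => a := funext fun _ => eval_C a
    exact hC ▸ Function.HasTemperateGrowth.const a
  | add p q hp hq =>
    have hadd : symbol (p + q) = symbol p + symbol q := funext fun _ => map_add _ _ _
    exact hadd ▸ hp.add hq
  | mul_X p j hp =>
    have hmul : symbol (p * X j) = symbol p * fun ξ => ξ j :=
      funext fun _ => (map_mul _ _ _).trans (by rw [eval_X]; rfl)
    exact hmul ▸ hp.mul (hasTemperateGrowth_coord j)

/-- The Fourier multiplier of `Q(D)`. Mathlib's Fourier transform has the kernel `e^{-2πi x·ξ}`, so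
that `D_j` acts as multiplication by `2πξ_j`. -/
noncomputable def multiplier (Q : MvPolynomial (Fin n) ℝ) (ξ : ℝⁿ) : ℂ :=
  (symbol Q ((2 * π) • ξ) : ℂ)

@[fun_prop]
theorem hasTemperateGrowth_multiplier (Q : MvPolynomial (Fin n) ℝ) :
    Function.HasTemperateGrowth (multiplier Q) := by
  have hscale : Function.HasTemperateGrowth fun ξ : ℝⁿ => (2 * π) • ξ := by fun_prop
  exact Function.Complex.hasTemperateGrowth_ofReal.comp ((hasTemperateGrowth_symbol Q).comp hscale)

theorem fourier_fourierMultiplierCLM {g : ℝⁿ → ℂ} (hg : g.HasTemperateGrowth) (f : 𝓢(ℝⁿ, ℂ))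
    (ξ : ℝⁿ) : 𝓕 (fourierMultiplierCLM ℂ g f) ξ = g ξ * 𝓕 f ξ := by
  rw [fourierMultiplierCLM_apply, fourier_fourierInv_eq, smulLeftCLM_apply_apply hg, smul_eq_mul]

theorem fourier_ext {f g : 𝓢(ℝⁿ, ℂ)} (h : ∀ ξ, 𝓕 f ξ = 𝓕 g ξ) : f = g :=
  (FourierTransform.fourierEquiv ℂ 𝓢(ℝⁿ, ℂ)).injective (SchwartzMap.ext h)

/-- The operator `Q(D)` on Schwartz functions, depending on `Q` through a ring homomorphism. -/
noncomputable def opD : MvPolynomial (Fin n) ℝ →+* (𝓢(ℝⁿ, ℂ) →L[ℂ] 𝓢(ℝⁿ, ℂ)) :=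
  RingHom.mk'
    { toFun := fun Q => fourierMultiplierCLM ℂ (multiplier Q)
      map_one' := by
        have hone : multiplier (1 : MvPolynomial (Fin n) ℝ) = fun _ => 1 := by
          funext ξ
          simp [multiplier, symbol]
        rw [hone, fourierMultiplierCLM_const, one_smul]
        rfl
      map_mul' := fun Q R => by
        have hmul : multiplier (Q * R) = multiplier Q * multiplier R := by
          funext ξ
          simp [multiplier, symbol]
        rw [hmul, ← fourierMultiplierCLM_compL_fourierMultiplierCLM (by fun_prop) (by fun_prop)]
        rfl }
    fun Q R => by
      ext1 f
      refine fourier_ext fun ξ => ?_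
      have hadd : multiplier (Q + R) ξ = multiplier Q ξ + multiplier R ξ := by
        simp [multiplier, symbol]
      simp only [MonoidHom.coe_mk, OneHom.coe_mk, add_apply, FourierTransform.fourier_add,
        fourier_fourierMultiplierCLM (hasTemperateGrowth_multiplier _), hadd, add_mul]

theorem fourier_opD (Q : MvPolynomial (Fin n) ℝ) (f : 𝓢(ℝⁿ, ℂ)) (ξ : ℝⁿ) :
    𝓕 (opD Q f) ξ = multiplier Q ξ * 𝓕 f ξ :=
  fourier_fourierMultiplierCLM (hasTemperateGrowth_multiplier Q) f ξ

theorem opD_mul_apply (Q R : MvPolynomial (Fin n) ℝ) (f : 𝓢(ℝⁿ, ℂ)) :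
    opD (Q * R) f = opD Q (opD R f) := by
  rw [map_mul, mul_apply_eq_comp]

theorem opD_C (a : ℝ) (f : 𝓢(ℝⁿ, ℂ)) : opD (C a) f = (a : ℂ) • f :=
  fourier_ext fun ξ => by
    rw [fourier_opD, FourierTransform.fourier_smul, smul_apply, smul_eq_mul, multiplier, symbol,
      eval_C]

theorem opD_X (j : Fin n) (f : 𝓢(ℝⁿ, ℂ)) :
    opD (X j) f = -Complex.I • ∂_{(EuclideanSpace.single j (1 : ℝ))} f :=
  fourier_ext fun ξ => by
    rw [fourier_opD, FourierTransform.fourier_smul, smul_apply, fourier_lineDerivOp_eq, smul_apply,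
      smulLeftCLM_apply_apply (by fun_prop)]
    simp only [multiplier, symbol, eval_X, PiLp.smul_apply, smul_eq_mul, Complex.ofReal_mul,
      Complex.ofReal_ofNat, EuclideanSpace.inner_single_right, Complex.real_smul, conj_trivial,
      one_mul]
    linear_combination (2 * π * ξ j * 𝓕 f ξ) * Complex.I_mul_I

theorem coe_opD_X (j : Fin n) (f : 𝓢(ℝⁿ, ℂ)) : ⇑(opD (X j) f) = D j f := by
  funext x
  rw [opD_X, smul_apply, lineDerivOp_apply_eq_fderiv, D, smul_eq_mul]

theorem iterate_D_eq_opD (j : Fin n) (a : ℕ) (f : 𝓢(ℝⁿ, ℂ)) :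
    (D j)^[a] f = ⇑(opD (X j ^ a) f) := by
  induction a with
  | zero => rw [pow_zero, map_one, one_apply_eq_self, Function.iterate_zero, id]
  | succ a ih => rw [Function.iterate_succ_apply', ih, pow_succ', opD_mul_apply, coe_opD_X]

theorem multiD_eq_opD (α : Fin n →₀ ℕ) (f : 𝓢(ℝⁿ, ℂ)) :
    multiD α f = ⇑(opD (monomial α 1) f) := by
  have hfold (l : List (Fin n)) : l.foldr (fun j g => (D j)^[α j] g) f =
      ⇑(opD ((l.map fun j => X j ^ α j).prod) f) := by
    induction l with
    | nil => rw [List.map_nil, List.prod_nil, map_one, one_apply_eq_self, List.foldr_nil]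
    | cons j l ih =>
      rw [List.foldr_cons, ih, iterate_D_eq_opD, List.map_cons, List.prod_cons, opD_mul_apply]
  rw [multiD, hfold, monic_monomial_eq, Finsupp.prod_fintype _ _ fun _ => pow_zero _,
    ← List.prod_ofFn, List.ofFn_eq_map]

theorem diffOp_eq_opD (Q : MvPolynomial (Fin n) ℝ) (f : 𝓢(ℝⁿ, ℂ)) : diffOp Q f = ⇑(opD Q f) := by
  funext x
  conv_rhs => rw [Q.as_sum, map_sum, sum_apply, sum_apply]
  refine Finset.sum_congr rfl fun α _ => ?_
  rw [multiD_eq_opD, ← mul_one (Q.coeff α), ← C_mul_monomial, opD_mul_apply, opD_C, smul_apply,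
    smul_eq_mul, mul_one]

/-- Multiplication of Schwartz functions by the coordinate `x_k`. -/
noncomputable def coordMul (k : Fin n) : 𝓢(ℝⁿ, ℂ) →L[ℂ] 𝓢(ℝⁿ, ℂ) :=
  smulLeftCLM ℂ fun x => ((x k : ℝ) : ℂ)

theorem coordMul_apply (k : Fin n) (f : 𝓢(ℝⁿ, ℂ)) (x : ℝⁿ) :
    coordMul k f x = (x k : ℂ) * f x := by
  rw [coordMul, smulLeftCLM_apply_apply (by fun_prop), smul_eq_mul]

theorem opD_X_coordMul (j k : Fin n) (f : 𝓢(ℝⁿ, ℂ)) :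
    opD (X j) (coordMul k f) =
      coordMul k (opD (X j) f) - Complex.I • opD (pderiv k (X j)) f := by
  ext x
  have hcoe : (coordMul k f : ℝⁿ → ℂ) = fun x => (x k : ℂ) * f x := funext (coordMul_apply k f)
  have hcoord : HasFDerivAt (fun x : ℝⁿ => (x k : ℂ))
      (Complex.ofRealCLM ∘L EuclideanSpace.proj (𝕜 := ℝ) k) x :=
    (Complex.ofRealCLM ∘L EuclideanSpace.proj (𝕜 := ℝ) k).hasFDerivAt
  rw [coe_opD_X, sub_apply, smul_apply, coordMul_apply, coe_opD_X, D, D, hcoe,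
    (hcoord.fun_mul (f.hasFDerivAt x)).fderiv]
  rcases eq_or_ne j k with rfl | hjk
  · simp only [add_apply, smul_apply, smul_eq_mul, ContinuousLinearMap.comp_apply,
      PiLp.proj_apply, PiLp.single_eq_same, Complex.ofRealCLM_apply, Complex.ofReal_one, mul_one,
      neg_mul, mul_neg, pderiv_X, Pi.single_eq_same, map_one, one_apply_eq_self]
    ring
  · simp only [add_apply, smul_apply, smul_eq_mul, ContinuousLinearMap.comp_apply,
      PiLp.proj_apply, ne_eq, hjk.symm, not_false_eq_true, PiLp.single_eq_of_ne,
      mul_zero, add_zero, neg_mul, mul_neg,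
      pderiv_X_of_ne hjk, map_zero, zero_apply, sub_zero, neg_inj]
    ring

theorem opD_coordMul (Q : MvPolynomial (Fin n) ℝ) (k : Fin n) (f : 𝓢(ℝⁿ, ℂ)) :
    opD Q (coordMul k f) = coordMul k (opD Q f) - Complex.I • opD (pderiv k Q) f := by
  induction Q using MvPolynomial.induction_on generalizing f with
  | C a => simp [opD_C]
  | add p q hp hq =>
    simp only [map_add, add_apply, hp, hq, smul_add]
    abel
  | mul_X p j hp =>
    simp only [opD_mul_apply, opD_X_coordMul, map_sub, map_smul, hp, pderiv_mul, map_add,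
      add_apply, smul_add, sub_sub]

theorem tsupport_opD_subset (Q : MvPolynomial (Fin n) ℝ) (f : 𝓢(ℝⁿ, ℂ)) :
    tsupport (opD Q f) ⊆ tsupport f := by
  induction Q using MvPolynomial.induction_on generalizing f with
  | C a =>
    rw [opD_C]
    exact closure_mono (Function.support_const_smul_subset (a : ℂ) f)
  | add p q hp hq =>
    rw [map_add]
    exact (tsupport_add _ _).trans (Set.union_subset (hp f) (hq f))
  | mul_X p j hp =>
    rw [opD_mul_apply]
    refine (hp _).trans ?_
    rw [opD_X]
    exact (closure_mono (Function.support_const_smul_subset (-Complex.I) _)).trans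
      (tsupport_lineDerivOp_subset _ f)

/-- The class of a Schwartz function in `L²(ℝⁿ)`. -/
noncomputable def toL2 : 𝓢(ℝⁿ, ℂ) →L[ℂ] (ℝⁿ →₂[volume] ℂ) :=
  toLpCLM ℂ ℂ 2 volume

theorem coeFn_toL2 (f : 𝓢(ℝⁿ, ℂ)) : toL2 f =ᵐ[volume] f :=
  f.coeFn_toLp 2 volume

theorem inner_toL2 (f g : 𝓢(ℝⁿ, ℂ)) :
    inner ℂ (toL2 f) (toL2 g) = ∫ x, inner ℂ (f x) (g x) :=
  inner_toL2_toL2_eq f g volume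

theorem inner_toL2_fourier (f g : 𝓢(ℝⁿ, ℂ)) :
    inner ℂ (toL2 (𝓕 f)) (toL2 (𝓕 g)) = inner ℂ (toL2 f) (toL2 g) :=
  inner_fourier_toL2_eq f g

theorem inner_opD_left (Q : MvPolynomial (Fin n) ℝ) (f g : 𝓢(ℝⁿ, ℂ)) :
    inner ℂ (toL2 (opD Q f)) (toL2 g) = inner ℂ (toL2 f) (toL2 (opD Q g)) := by
  rw [← inner_toL2_fourier, ← inner_toL2_fourier f, inner_toL2, inner_toL2]
  refine integral_congr_ae (ae_of_all _ fun ξ => ?_)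
  simp only [fourier_opD, RCLike.inner_apply, multiplier, map_mul, Complex.conj_ofReal]
  ring

theorem norm_toL2_coordMul_le {A : ℝ} (k : Fin n) {f : 𝓢(ℝⁿ, ℂ)}
    (hf : tsupport f ⊆ Metric.closedBall 0 A) : ‖toL2 (coordMul k f)‖ ≤ A * ‖toL2 f‖ := by
  refine Lp.norm_le_mul_norm_of_ae_le_mul ?_
  filter_upwards [coeFn_toL2 (coordMul k f), coeFn_toL2 f] with x hxf hf_eq
  rw [hxf, hf_eq, coordMul_apply, norm_mul, Complex.norm_real]
  by_cases hx : x ∈ tsupport f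
  · gcongr
    exact (PiLp.norm_apply_le x k).trans (mem_closedBall_zero_iff.1 (hf hx))
  · simp [image_eq_zero_of_notMem_tsupport hx]

theorem I_mul_inner_opD_pderiv_self (Q : MvPolynomial (Fin n) ℝ) (k : Fin n) (f : 𝓢(ℝⁿ, ℂ)) :
    Complex.I * inner ℂ (toL2 (opD (pderiv k Q) f)) (toL2 (opD (pderiv k Q) f)) =
      inner ℂ (toL2 (opD (pderiv k Q) f)) (toL2 (coordMul k (opD Q f))) -
      inner ℂ (toL2 (opD Q f)) (toL2 (coordMul k (opD (pderiv k Q) f)) -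
        Complex.I • toL2 (opD (pderiv k (pderiv k Q)) f)) := by
  have hcomm : Complex.I • toL2 (opD (pderiv k Q) f) =
      toL2 (coordMul k (opD Q f)) - toL2 (opD Q (coordMul k f)) := by
    rw [opD_coordMul, map_sub, map_smul, sub_sub_cancel]
  have hsymm : inner ℂ (toL2 (opD (pderiv k Q) f)) (toL2 (opD Q (coordMul k f))) =
      inner ℂ (toL2 (opD Q f)) (toL2 (opD (pderiv k Q) (coordMul k f))) := by
    rw [inner_opD_left, ← opD_mul_apply, mul_comm, opD_mul_apply, ← inner_opD_left]
  rw [← inner_smul_right, hcomm, inner_sub_right, hsymm, opD_coordMul, map_sub, map_smul]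

theorem norm_opD_pderiv_sq_le {A : ℝ} (Q : MvPolynomial (Fin n) ℝ) (k : Fin n) {f : 𝓢(ℝⁿ, ℂ)}
    (hf : tsupport f ⊆ Metric.closedBall 0 A) :
    ‖toL2 (opD (pderiv k Q) f)‖ ^ 2 ≤ (2 * A * ‖toL2 (opD (pderiv k Q) f)‖ +
      ‖toL2 (opD (pderiv k (pderiv k Q)) f)‖) * ‖toL2 (opD Q f)‖ := by
  set g := opD Q f
  set g' := opD (pderiv k Q) f
  set g'' := opD (pderiv k (pderiv k Q)) f
  have hxg : ‖toL2 (coordMul k g)‖ ≤ A * ‖toL2 g‖ :=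
    norm_toL2_coordMul_le k ((tsupport_opD_subset Q f).trans hf)
  have hxg' : ‖toL2 (coordMul k g')‖ ≤ A * ‖toL2 g'‖ :=
    norm_toL2_coordMul_le k ((tsupport_opD_subset _ f).trans hf)
  calc ‖toL2 g'‖ ^ 2
      = ‖Complex.I * inner ℂ (toL2 g') (toL2 g')‖ := by
        rw [norm_mul, Complex.norm_I, one_mul, inner_self_eq_norm_sq_to_K]
        simp
    _ ≤ ‖toL2 g'‖ * ‖toL2 (coordMul k g)‖ +
          ‖toL2 g‖ * ‖toL2 (coordMul k g') - Complex.I • toL2 g''‖ := by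
        rw [I_mul_inner_opD_pderiv_self]
        exact (norm_sub_le _ _).trans
          (add_le_add (norm_inner_le_norm _ _) (norm_inner_le_norm _ _))
    _ ≤ ‖toL2 g'‖ * (A * ‖toL2 g‖) + ‖toL2 g‖ * (A * ‖toL2 g'‖ + ‖toL2 g''‖) := by
        gcongr
        refine (norm_sub_le _ _).trans ?_
        rw [norm_smul, Complex.norm_I, one_mul]
        gcongr
    _ = (2 * A * ‖toL2 g'‖ + ‖toL2 g''‖) * ‖toL2 g‖ := by ring

theorem norm_opD_pderiv_le_of_iterate_eq_zero {A : ℝ} (hA : 0 ≤ A) (k : Fin n) (N : ℕ)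
    (Q : MvPolynomial (Fin n) ℝ) (hQ : (pderiv k)^[N + 1] Q = 0) {f : 𝓢(ℝⁿ, ℂ)}
    (hf : tsupport f ⊆ Metric.closedBall 0 A) :
    ‖toL2 (opD (pderiv k Q) f)‖ ≤ 2 * A * N * ‖toL2 (opD Q f)‖ := by
  induction N generalizing Q with
  | zero =>
    have hQ' : pderiv k Q = 0 := hQ
    simp [hQ']
  | succ N ih =>
    have hQ' := ih (pderiv k Q) (by rwa [Function.iterate_succ_apply] at hQ)
    have hsq := norm_opD_pderiv_sq_le Q k hf
    set a := ‖toL2 (opD (pderiv k Q) f)‖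
    have ha : 0 ≤ a := norm_nonneg _
    rcases ha.eq_or_lt with ha0 | ha_pos
    · rw [← ha0]; positivity
    refine le_of_mul_le_mul_left ?_ ha_pos
    calc a * a = a ^ 2 := (sq a).symm
      _ ≤ (2 * A * a + 2 * A * N * a) * ‖toL2 (opD Q f)‖ := hsq.trans (by gcongr)
      _ = a * (2 * A * (N + 1 : ℕ) * ‖toL2 (opD Q f)‖) := by push_cast; ring

theorem iterate_pderiv_eq_zero {R σ : Type*} [CommSemiring R] (k : σ) (N : ℕ)
    (Q : MvPolynomial σ R) (hQ : ∀ m : σ →₀ ℕ, N ≤ m k → Q.coeff m = 0) :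
    (pderiv k)^[N] Q = 0 := by
  induction N generalizing Q with
  | zero => exact MvPolynomial.ext _ _ fun m => by simpa using hQ m (Nat.zero_le _)
  | succ N ih =>
    rw [Function.iterate_succ_apply]
    refine ih _ fun m hm => ?_
    rw [coeff_pderiv, hQ _ (by simpa using hm), zero_mul]

/-- `R(D)` is `L²`-bounded relative to `Q(D)` on Schwartz functions supported in `K`. -/
def RelBoundedOn (K : Set ℝⁿ) (R Q : MvPolynomial (Fin n) ℝ) : Prop :=
  ∃ C : ℝ, 0 ≤ C ∧ ∀ f : 𝓢(ℝⁿ, ℂ), tsupport f ⊆ K →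
    ‖toL2 (opD R f)‖ ≤ C * ‖toL2 (opD Q f)‖

theorem RelBoundedOn.refl (K : Set ℝⁿ) (Q : MvPolynomial (Fin n) ℝ) : RelBoundedOn K Q Q :=
  ⟨1, zero_le_one, fun _ _ => (one_mul _).ge⟩

theorem RelBoundedOn.trans {K : Set ℝⁿ} {S R Q : MvPolynomial (Fin n) ℝ}
    (hSR : RelBoundedOn K S R) (hRQ : RelBoundedOn K R Q) : RelBoundedOn K S Q := by
  obtain ⟨C, hC, hS⟩ := hSR
  obtain ⟨C', hC', hR⟩ := hRQ
  refine ⟨C * C', by positivity, fun f hf => (hS f hf).trans ?_⟩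
  rw [mul_assoc]
  exact mul_le_mul_of_nonneg_left (hR f hf) hC

theorem RelBoundedOn.pderiv {K : Set ℝⁿ} (hK : Bornology.IsBounded K) (k : Fin n)
    (Q : MvPolynomial (Fin n) ℝ) : RelBoundedOn K (MvPolynomial.pderiv k Q) Q := by
  obtain ⟨A, hA, hKA⟩ := hK.subset_closedBall_lt 0 0
  refine ⟨2 * A * Q.degreeOf k, by positivity, fun f hf =>
    norm_opD_pderiv_le_of_iterate_eq_zero hA.le k _ Q
      (iterate_pderiv_eq_zero k _ Q fun m hm => ?_) (hf.trans hKA)⟩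
  by_contra hcoeff
  have := monomial_le_degreeOf k (mem_support_iff.2 hcoeff)
  lia

theorem RelBoundedOn.multiDeriv {K : Set ℝⁿ} (hK : Bornology.IsBounded K) (α : Fin n → ℕ)
    (Q : MvPolynomial (Fin n) ℝ) : RelBoundedOn K (multiDeriv α Q) Q := by
  have hiter (k : Fin n) (a : ℕ) (R : MvPolynomial (Fin n) ℝ) :
      RelBoundedOn K ((MvPolynomial.pderiv k)^[a] R) R := by
    induction a with
    | zero => exact .refl K R
    | succ a ih =>
      rw [Function.iterate_succ_apply']
      exact (RelBoundedOn.pderiv hK k _).trans ih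
  have hfold (l : List (Fin n)) :
      RelBoundedOn K (l.foldr (fun j R => (MvPolynomial.pderiv j)^[α j] R) Q) Q := by
    induction l with
    | nil => exact .refl K Q
    | cons j l ih => exact (hiter j (α j) _).trans ih
  exact hfold _

end ConstantCoefficient

section BoundedMultiplier

variable {α : Type*} {m : MeasurableSpace α} {μ : Measure α}

theorem integrable_norm_sq_coeFn {E : Type*} [NormedAddCommGroup E] (f : Lp E 2 μ) :
    Integrable (fun x => ‖f x‖ ^ 2) μ :=
  (memLp_two_iff_integrable_sq_norm (Lp.aestronglyMeasurable f)).1 (Lp.memLp f)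

theorem norm_sq_eq_integral_norm_sq {E : Type*} [NormedAddCommGroup E] (f : Lp E 2 μ) :
    ‖f‖ ^ 2 = ∫ x, ‖f x‖ ^ 2 ∂μ := by
  have hnonneg : 0 ≤ ∫ x, ‖f x‖ ^ 2 ∂μ := integral_nonneg fun _ => by positivity
  rw [Lp.norm_def, (Lp.memLp f).eLpNorm_eq_integral_rpow_norm two_ne_zero ENNReal.ofNat_ne_top,
    ENNReal.toReal_ofReal (by positivity)]
  simp only [ENNReal.toReal_ofNat, Real.rpow_ofNat]
  exact_mod_cast Real.rpow_inv_natCast_pow hnonneg two_ne_zero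

variable {𝕜 : Type*} [RCLike 𝕜]

/-- Multiplication by a bounded function, as an operator on `L²`. -/
noncomputable def mulL2 {r : α → 𝕜} (hr : MemLp r ∞ μ) : Lp 𝕜 2 μ →L[𝕜] Lp 𝕜 2 μ :=
  (ContinuousLinearMap.mul 𝕜 𝕜).holderL μ ∞ 2 2 (hr.toLp r)

theorem coeFn_mulL2 {r : α → 𝕜} (hr : MemLp r ∞ μ) (f : Lp 𝕜 2 μ) :
    mulL2 hr f =ᵐ[μ] fun x => r x * f x := by
  filter_upwards [(ContinuousLinearMap.mul 𝕜 𝕜).coeFn_holder (r := 2) (hr.toLp r) f,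
    hr.coeFn_toLp] with x hmul hrx
  exact hmul.trans (by rw [hrx, ContinuousLinearMap.mul_apply'])

theorem le_re_inner_mulL2 {r : α → ℝ} {c : ℝ} (hr : MemLp (fun x => (r x : 𝕜)) ∞ μ)
    (hc : ∀ᵐ x ∂μ, c ≤ r x) (f : Lp 𝕜 2 μ) :
    c * ‖f‖ ^ 2 ≤ RCLike.re (inner 𝕜 f (mulL2 hr f)) := by
  have hint := L2.integrable_inner (𝕜 := 𝕜) f (mulL2 hr f)
  rw [norm_sq_eq_integral_norm_sq, ← integral_const_mul, L2.inner_def, ← integral_re hint]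
  refine integral_mono_ae ((integrable_norm_sq_coeFn f).const_mul c) hint.re ?_
  filter_upwards [hc, coeFn_mulL2 hr f] with x hx hmul
  have hre : RCLike.re (inner 𝕜 (f x) ((r x : 𝕜) * f x)) = r x * ‖f x‖ ^ 2 := by
    rw [← smul_eq_mul, inner_smul_right, inner_self_eq_norm_sq_to_K, RCLike.re_ofReal_mul]
    norm_cast
  rw [hmul, hre]
  exact mul_le_mul_of_nonneg_right hx (by positivity)

end BoundedMultiplier

section CompactEmbedding

open SchwartzMap FourierTransform
open scoped SchwartzMap Real

variable {n : ℕ}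

local notation "ℝⁿ" => EuclideanSpace ℝ (Fin n)

theorem exists_norm_inner_le_of_isCompact {𝕜 E : Type*} [RCLike 𝕜] [NormedAddCommGroup E]
    [InnerProductSpace 𝕜 E] {S : Set E} (hS : IsCompact S) {ε : ℝ} (hε : 0 < ε) :
    ∃ (N : ℕ) (l : E →L[𝕜] (Fin N → 𝕜)), ∀ y ∈ S, ∀ x,
      ‖inner 𝕜 y x‖ ≤ ε * ‖x‖ + ‖l x‖ := by
  obtain ⟨t, -, ht, hcover⟩ := Metric.finite_approx_of_totallyBounded hS.totallyBounded ε hε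
  have := ht.fintype
  let e := Fintype.equivFin t
  refine ⟨_, ContinuousLinearMap.pi fun i => innerSL 𝕜 (e.symm i : E), fun y hy x => ?_⟩
  obtain ⟨y', hy', hyy'⟩ := Set.mem_iUnion₂.1 (hcover hy)
  rw [Metric.mem_ball, dist_eq_norm] at hyy'
  have hcoord := norm_le_pi_norm
    (ContinuousLinearMap.pi (fun i => innerSL 𝕜 (e.symm i : E)) x) (e ⟨y', hy'⟩)
  rw [ContinuousLinearMap.pi_apply, e.symm_apply_apply, innerSL_apply_apply] at hcoord
  calc ‖inner 𝕜 y x‖ = ‖inner 𝕜 (y - y') x + inner 𝕜 y' x‖ := by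
        rw [← inner_add_left, sub_add_cancel]
    _ ≤ ‖y - y'‖ * ‖x‖ + ‖inner 𝕜 y' x‖ :=
        (norm_add_le _ _).trans (add_le_add_left (norm_inner_le_norm _ _) _)
    _ ≤ _ := by gcongr

theorem norm_toL2_sq (f : 𝓢(ℝⁿ, ℂ)) : ‖toL2 f‖ ^ 2 = ∫ ξ, ‖𝓕 f ξ‖ ^ 2 := by
  rw [integral_norm_sq_fourier, norm_sq_eq_integral_norm_sq]
  exact integral_congr_ae ((coeFn_toL2 f).mono fun x hx => by simp only [hx])

theorem integrable_norm_fourier_sq (f : 𝓢(ℝⁿ, ℂ)) : Integrable fun ξ => ‖𝓕 f ξ‖ ^ 2 :=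
  (memLp_two_iff_integrable_sq_norm (𝓕 f).continuous.aestronglyMeasurable).1 ((𝓕 f).memLp 2)

theorem norm_fourier_opD_sq (Q : MvPolynomial (Fin n) ℝ) (f : 𝓢(ℝⁿ, ℂ)) (ξ : ℝⁿ) :
    ‖𝓕 (opD Q f) ξ‖ ^ 2 = |symbol Q ((2 * π) • ξ)| ^ 2 * ‖𝓕 f ξ‖ ^ 2 := by
  rw [fourier_opD, norm_mul, mul_pow, multiplier, Complex.norm_real, Real.norm_eq_abs]

theorem symbolTilde_sq_mul_norm_fourier_sq (P : MvPolynomial (Fin n) ℝ) (f : 𝓢(ℝⁿ, ℂ)) (ξ : ℝⁿ) :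
    symbolTilde P ((2 * π) • ξ) ^ 2 * ‖𝓕 f ξ‖ ^ 2 = ∑ α : Fin n → Fin (P.totalDegree + 1),
      ‖𝓕 (opD (multiDeriv (fun j => (α j : ℕ)) P) f) ξ‖ ^ 2 := by
  rw [symbolTilde, Real.sq_sqrt (Finset.sum_nonneg fun _ _ => by positivity), Finset.sum_mul]
  exact Finset.sum_congr rfl fun α _ => (norm_fourier_opD_sq _ f ξ).symm

theorem integrable_symbolTilde_sq_mul (P : MvPolynomial (Fin n) ℝ) (f : 𝓢(ℝⁿ, ℂ)) :
    Integrable fun ξ => symbolTilde P ((2 * π) • ξ) ^ 2 * ‖𝓕 f ξ‖ ^ 2 := by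
  simp only [symbolTilde_sq_mul_norm_fourier_sq]
  exact integrable_finsetSum _ fun α _ => integrable_norm_fourier_sq _

theorem exists_integral_symbolTilde_sq_le {K : Set ℝⁿ} (hK : Bornology.IsBounded K)
    (P : MvPolynomial (Fin n) ℝ) :
    ∃ C : ℝ, 0 ≤ C ∧ ∀ f : 𝓢(ℝⁿ, ℂ), tsupport f ⊆ K →
      ∫ ξ, symbolTilde P ((2 * π) • ξ) ^ 2 * ‖𝓕 f ξ‖ ^ 2 ≤ C * ‖toL2 (opD P f)‖ ^ 2 := by
  choose C _ hC using fun α : Fin n → Fin (P.totalDegree + 1) =>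
    RelBoundedOn.multiDeriv hK (fun j => (α j : ℕ)) P
  refine ⟨∑ α, C α ^ 2, by positivity, fun f hf => ?_⟩
  simp only [symbolTilde_sq_mul_norm_fourier_sq]
  rw [integral_finsetSum _ fun α _ => integrable_norm_fourier_sq _, Finset.sum_mul]
  refine Finset.sum_le_sum fun α _ => ?_
  rw [← norm_toL2_sq, ← mul_pow]
  exact pow_le_pow_left₀ (norm_nonneg _) (hC α f hf) 2

theorem exists_le_symbolTilde {P : MvPolynomial (Fin n) ℝ}
    (hP : Tendsto (symbolTilde P) (cocompact ℝⁿ) atTop) (M : ℝ) :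
    ∃ R : ℝ, ∀ ξ ∈ (Metric.closedBall (0 : ℝⁿ) R)ᶜ, M ≤ symbolTilde P ((2 * π) • ξ) := by
  have hscale : Tendsto (fun ξ : ℝⁿ => (2 * π) • ξ) (cocompact ℝⁿ) (cocompact ℝⁿ) :=
    (Homeomorph.smulOfNeZero (2 * π) (by positivity)).isClosedEmbedding.tendsto_cocompact
  obtain ⟨R, -, hR⟩ := (Metric.hasBasis_cobounded_compl_closedBall (0 : ℝⁿ)).eventually_iff.1 <|
    Metric.cobounded_eq_cocompact (α := ℝⁿ) ▸ (hP.comp hscale).eventually_ge_atTop M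
  exact ⟨R, fun ξ hξ => hR hξ⟩

theorem exists_setIntegral_norm_fourier_sq_compl_le {K : Set ℝⁿ} (hK : Bornology.IsBounded K)
    {P : MvPolynomial (Fin n) ℝ} (hP : Tendsto (symbolTilde P) (cocompact ℝⁿ) atTop) {ε : ℝ}
    (hε : 0 < ε) :
    ∃ R : ℝ, ∀ f : 𝓢(ℝⁿ, ℂ), tsupport f ⊆ K →
      ∫ ξ in (Metric.closedBall 0 R)ᶜ, ‖𝓕 f ξ‖ ^ 2 ≤ ε * ‖toL2 (opD P f)‖ ^ 2 := by
  obtain ⟨C, hC_nonneg, hC⟩ := exists_integral_symbolTilde_sq_le hK P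
  obtain ⟨R, hR⟩ := exists_le_symbolTilde hP √((C + 1) / ε)
  refine ⟨R, fun f hf => ?_⟩
  set σ : ℝⁿ → ℝ := fun ξ => symbolTilde P ((2 * π) • ξ) ^ 2 * ‖𝓕 f ξ‖ ^ 2
  have hσ : Integrable σ := integrable_symbolTilde_sq_mul P f
  have hσ_ge : ∀ ξ ∈ (Metric.closedBall (0 : ℝⁿ) R)ᶜ,
      (C + 1) / ε * ‖𝓕 f ξ‖ ^ 2 ≤ σ ξ := fun ξ hξ => by
    refine mul_le_mul_of_nonneg_right ?_ (by positivity)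
    exact (Real.sqrt_le_left (Real.sqrt_nonneg _)).1 (hR ξ hξ)
  have hmono : (C + 1) / ε * ∫ ξ in (Metric.closedBall 0 R)ᶜ, ‖𝓕 f ξ‖ ^ 2 ≤
      (C + 1) * ‖toL2 (opD P f)‖ ^ 2 :=
    calc (C + 1) / ε * ∫ ξ in (Metric.closedBall 0 R)ᶜ, ‖𝓕 f ξ‖ ^ 2
        ≤ ∫ ξ in (Metric.closedBall 0 R)ᶜ, σ ξ := by
          rw [← integral_const_mul]
          exact setIntegral_mono_on ((integrable_norm_fourier_sq f).const_mul _).integrableOn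
            hσ.integrableOn measurableSet_closedBall.compl hσ_ge
      _ ≤ ∫ ξ, σ ξ := setIntegral_le_integral hσ (ae_of_all _ fun ξ => by positivity)
      _ ≤ (C + 1) * ‖toL2 (opD P f)‖ ^ 2 := (hC f hf).trans (by gcongr; linarith)
  rw [div_mul_eq_mul_div, mul_div_assoc] at hmono
  rw [← div_le_iff₀' hε]
  exact le_of_mul_le_mul_left hmono (by positivity)

/-- The plane wave `e^{2πi x·ξ}` cut off to the ball of radius `A`, whose `L²` inner product with a
function supported in that ball is the Fourier transform at `ξ`. -/
noncomputable def cutoffWave (A : ℝ) (ξ : ℝⁿ) : ℝⁿ → ℂ :=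
  (Metric.closedBall 0 A).indicator fun x => Complex.exp ((2 * π * inner ℝ x ξ : ℝ) * Complex.I)

theorem memLp_cutoffWave (A : ℝ) (ξ : ℝⁿ) : MemLp (cutoffWave A ξ) 2 volume := by
  refine (memLp_indicator_iff_restrict measurableSet_closedBall).2 ?_
  have : IsFiniteMeasure (volume.restrict (Metric.closedBall (0 : ℝⁿ) A)) :=
    ⟨by simpa using measure_closedBall_lt_top⟩
  refine MemLp.of_bound (Continuous.aestronglyMeasurable (by fun_prop)) 1 (ae_of_all _ fun x => ?_)
  rw [Complex.norm_exp_ofReal_mul_I]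

theorem inner_cutoffWave {A : ℝ} {f : 𝓢(ℝⁿ, ℂ)} (hf : tsupport f ⊆ Metric.closedBall 0 A)
    (ξ : ℝⁿ) : inner ℂ ((memLp_cutoffWave A ξ).toLp _) (toL2 f) = 𝓕 f ξ := by
  rw [L2.inner_def, fourier_coe, Real.fourier_eq']
  refine integral_congr_ae ?_
  filter_upwards [(memLp_cutoffWave A ξ).coeFn_toLp, coeFn_toL2 f] with x hwave hfx
  rw [hwave, hfx, RCLike.inner_apply, smul_eq_mul, mul_comm]
  by_cases hx : x ∈ tsupport f
  · rw [cutoffWave, Set.indicator_of_mem (hf hx), ← Complex.exp_conj, map_mul, Complex.conj_I,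
      Complex.conj_ofReal, mul_neg, Complex.ofReal_mul, Complex.ofReal_mul, Complex.ofReal_mul,
      Complex.ofReal_mul, Complex.ofReal_neg]
    ring_nf
  · rw [image_eq_zero_of_notMem_tsupport hx, mul_zero, mul_zero]

theorem norm_cutoffWave_sub_le {A : ℝ} (ξ η x : ℝⁿ) :
    ‖cutoffWave A ξ x - cutoffWave A η x‖ ≤ 2 * π * A * ‖ξ - η‖ * ‖cutoffWave A 0 x‖ := by
  by_cases hx : x ∈ Metric.closedBall (0 : ℝⁿ) A
  · simp only [cutoffWave, Set.indicator_of_mem hx, Complex.norm_exp_ofReal_mul_I, mul_one]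
    have hfactor : Complex.exp ((2 * π * inner ℝ x ξ : ℝ) * Complex.I) -
        Complex.exp ((2 * π * inner ℝ x η : ℝ) * Complex.I) =
        Complex.exp ((2 * π * inner ℝ x η : ℝ) * Complex.I) *
          (Complex.exp (Complex.I * (2 * π * inner ℝ x (ξ - η) : ℝ)) - 1) := by
      rw [mul_sub, ← Complex.exp_add, mul_one, inner_sub_right]
      push_cast
      ring_nf
    rw [hfactor, norm_mul, Complex.norm_exp_ofReal_mul_I, one_mul]
    refine Real.norm_exp_I_mul_ofReal_sub_one_le.trans ?_
    rw [norm_mul, Real.norm_of_nonneg Real.two_pi_pos.le, mul_assoc (2 * π)]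
    gcongr
    exact (norm_inner_le_norm x (ξ - η)).trans (by gcongr; exact mem_closedBall_zero_iff.1 hx)
  · simp [cutoffWave, Set.indicator_of_notMem hx]

theorem continuous_toLp_cutoffWave (A : ℝ) :
    Continuous fun ξ : ℝⁿ => (memLp_cutoffWave A ξ).toLp _ := by
  refine (LipschitzWith.of_dist_le' (K := 2 * π * A * ‖(memLp_cutoffWave A (0 : ℝⁿ)).toLp _‖)
    fun ξ η => ?_).continuous
  rw [dist_eq_norm, dist_eq_norm, mul_right_comm, ← MemLp.toLp_sub]
  refine Lp.norm_le_mul_norm_of_ae_le_mul ?_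
  filter_upwards [((memLp_cutoffWave A ξ).sub (memLp_cutoffWave A η)).coeFn_toLp,
    (memLp_cutoffWave A (0 : ℝⁿ)).coeFn_toLp] with x hsub hzero
  rw [hsub, hzero]
  exact norm_cutoffWave_sub_le ξ η x

theorem exists_setIntegral_norm_fourier_sq_le {K : Set ℝⁿ} (hK : Bornology.IsBounded K) (R : ℝ)
    {ε : ℝ} (hε : 0 < ε) :
    ∃ (N : ℕ) (l : (ℝⁿ →₂[volume] ℂ) →L[ℂ] (Fin N → ℂ)), ∀ f : 𝓢(ℝⁿ, ℂ), tsupport f ⊆ K →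
      ∫ ξ in Metric.closedBall 0 R, ‖𝓕 f ξ‖ ^ 2 ≤ (ε * ‖toL2 f‖ + ‖l (toL2 f)‖) ^ 2 := by
  obtain ⟨A, hKA⟩ := hK.subset_closedBall 0
  set B : Set ℝⁿ := Metric.closedBall 0 R
  set b : ℝ := √(volume.real B + 1) with hb
  have hb_pos : 0 < b := by positivity
  obtain ⟨N, l, hl⟩ := exists_norm_inner_le_of_isCompact (𝕜 := ℂ)
    ((isCompact_closedBall (0 : ℝⁿ) R).image (continuous_toLp_cutoffWave A)) (div_pos hε hb_pos)
  refine ⟨N, (b : ℂ) • l, fun f hf => ?_⟩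
  have hsup : ∀ ξ ∈ B, ‖𝓕 f ξ‖ ≤ ε / b * ‖toL2 f‖ + ‖l (toL2 f)‖ := fun ξ hξ => by
    rw [← inner_cutoffWave (hf.trans hKA) ξ]
    exact hl _ ⟨ξ, hξ, rfl⟩ _
  calc ∫ ξ in B, ‖𝓕 f ξ‖ ^ 2
      ≤ ∫ _ in B, (ε / b * ‖toL2 f‖ + ‖l (toL2 f)‖) ^ 2 :=
        setIntegral_mono_on (integrable_norm_fourier_sq f).integrableOn
          (integrableOn_const measure_closedBall_lt_top.ne) measurableSet_closedBall
          fun ξ hξ => pow_le_pow_left₀ (norm_nonneg _) (hsup ξ hξ) 2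
    _ ≤ b ^ 2 * (ε / b * ‖toL2 f‖ + ‖l (toL2 f)‖) ^ 2 := by
        rw [setIntegral_const, smul_eq_mul, hb, Real.sq_sqrt (by positivity)]
        gcongr
        linarith
    _ = (ε * ‖toL2 f‖ + ‖((b : ℂ) • l) (toL2 f)‖) ^ 2 := by
        rw [smul_apply, norm_smul, Complex.norm_real, Real.norm_of_nonneg hb_pos.le]
        field_simp

theorem exists_norm_toL2_le {K : Set ℝⁿ} (hK : Bornology.IsBounded K)
    {P : MvPolynomial (Fin n) ℝ} (hP : Tendsto (symbolTilde P) (cocompact ℝⁿ) atTop) {ε : ℝ}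
    (hε : 0 < ε) :
    ∃ (N : ℕ) (l : (ℝⁿ →₂[volume] ℂ) →L[ℂ] (Fin N → ℂ)), ∀ f : 𝓢(ℝⁿ, ℂ), tsupport f ⊆ K →
      ‖toL2 f‖ ≤ ε * (‖toL2 f‖ + ‖toL2 (opD P f)‖) + ‖l (toL2 f)‖ := by
  obtain ⟨R, hhigh⟩ := exists_setIntegral_norm_fourier_sq_compl_le hK hP (sq_pos_of_pos hε)
  obtain ⟨N, l, hlow⟩ := exists_setIntegral_norm_fourier_sq_le hK R hε
  refine ⟨N, l, fun f hf => ?_⟩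
  set a := ε * ‖toL2 f‖ + ‖l (toL2 f)‖
  set b := ε * ‖toL2 (opD P f)‖ with hb
  have hsq : ‖toL2 f‖ ^ 2 ≤ (a + b) ^ 2 :=
    calc ‖toL2 f‖ ^ 2
        = (∫ ξ in Metric.closedBall 0 R, ‖𝓕 f ξ‖ ^ 2) +
            ∫ ξ in (Metric.closedBall 0 R)ᶜ, ‖𝓕 f ξ‖ ^ 2 := by
          rw [norm_toL2_sq,
            integral_add_compl measurableSet_closedBall (integrable_norm_fourier_sq f)]
      _ ≤ a ^ 2 + b ^ 2 := by
          rw [hb, mul_pow]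
          exact add_le_add (hlow f hf) (hhigh f hf)
      _ ≤ (a + b) ^ 2 := by nlinarith [show 0 ≤ a * b by positivity]
  calc ‖toL2 f‖ ≤ a + b := le_of_sq_le_sq hsq (by positivity)
    _ = _ := by ring

end CompactEmbedding

section MinimalDomain

open SchwartzMap FourierTransform
open scoped SchwartzMap Real

variable {n : ℕ} {Ω : Opens (EuclideanSpace ℝ (Fin n))}

local notation "ℝⁿ" => EuclideanSpace ℝ (Fin n)

/-- Test functions on `Ω` as Schwartz functions on `ℝⁿ`. -/
noncomputable def toSchwartz : 𝓓(Ω, ℂ) →ₗ[ℂ] 𝓢(ℝⁿ, ℂ) where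
  toFun φ := φ.hasCompactSupport.toSchwartzMap φ.contDiff
  map_add' _ _ := rfl
  map_smul' _ _ := rfl

theorem coe_toSchwartz (φ : 𝓓(Ω, ℂ)) : ⇑(toSchwartz φ) = φ := rfl

theorem diffOp_testFunction (Q : MvPolynomial (Fin n) ℝ) (φ : 𝓓(Ω, ℂ)) :
    diffOp Q φ = ⇑(opD Q (toSchwartz φ)) := by
  rw [← diffOp_eq_opD, coe_toSchwartz]

/-- The graph `φ ↦ (φ, P(D) φ)` of `P(D)` on test functions. -/
noncomputable def graphMap (Ω : Opens ℝⁿ) (P : MvPolynomial (Fin n) ℝ) :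
    𝓓(Ω, ℂ) →ₗ[ℂ] WithLp 2 ((ℝⁿ →₂[volume] ℂ) × (ℝⁿ →₂[volume] ℂ)) :=
  (WithLp.linearEquiv 2 ℂ _).symm.toLinearMap ∘ₗ
    (toL2.toLinearMap.prod (toL2 ∘L opD P).toLinearMap) ∘ₗ toSchwartz

/-- The Hilbert space `H_0^P(Ω)`, realised as the closure in `L² × L²` of the graph of `P(D)` on
test functions. -/
noncomputable def H0 (Ω : Opens ℝⁿ) (P : MvPolynomial (Fin n) ℝ) :
    Submodule ℂ (WithLp 2 ((ℝⁿ →₂[volume] ℂ) × (ℝⁿ →₂[volume] ℂ))) :=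
  (LinearMap.range (graphMap Ω P)).topologicalClosure

instance (P : MvPolynomial (Fin n) ℝ) : CompleteSpace (H0 Ω P) :=
  (Submodule.isClosed_topologicalClosure _).completeSpace_coe

/-- The embedding of `H_0^P(Ω)` into `L²(ℝⁿ)`. -/
noncomputable def H0.embed (Ω : Opens ℝⁿ) (P : MvPolynomial (Fin n) ℝ) :
    H0 Ω P →L[ℂ] (ℝⁿ →₂[volume] ℂ) :=
  WithLp.fstL 2 ℂ (ℝⁿ →₂[volume] ℂ) (ℝⁿ →₂[volume] ℂ) ∘L (H0 Ω P).subtypeL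

/-- The closed extension of `P(D)` to `H_0^P(Ω)`. -/
noncomputable def H0.op (Ω : Opens ℝⁿ) (P : MvPolynomial (Fin n) ℝ) :
    H0 Ω P →L[ℂ] (ℝⁿ →₂[volume] ℂ) :=
  WithLp.sndL 2 ℂ (ℝⁿ →₂[volume] ℂ) (ℝⁿ →₂[volume] ℂ) ∘L (H0 Ω P).subtypeL

/-- A test function as an element of `H_0^P(Ω)`. -/
noncomputable def H0.ofTest (P : MvPolynomial (Fin n) ℝ) (φ : 𝓓(Ω, ℂ)) : H0 Ω P :=
  ⟨graphMap Ω P φ, Submodule.le_topologicalClosure _ ⟨φ, rfl⟩⟩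

theorem H0.embed_ofTest (P : MvPolynomial (Fin n) ℝ) (φ : 𝓓(Ω, ℂ)) :
    H0.embed Ω P (H0.ofTest P φ) = toL2 (toSchwartz φ) := rfl

theorem H0.op_ofTest (P : MvPolynomial (Fin n) ℝ) (φ : 𝓓(Ω, ℂ)) :
    H0.op Ω P (H0.ofTest P φ) = toL2 (opD P (toSchwartz φ)) := rfl

theorem H0.denseRange_ofTest (P : MvPolynomial (Fin n) ℝ) :
    DenseRange (H0.ofTest P : 𝓓(Ω, ℂ) → H0 Ω P) := by
  intro h
  rw [Topology.IsInducing.subtypeVal.closure_eq_preimage_closure_image, Set.mem_preimage,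
    ← Set.range_comp]
  exact h.2

theorem H0.norm_sq_eq (P : MvPolynomial (Fin n) ℝ) (h : H0 Ω P) :
    ‖h‖ ^ 2 = ‖H0.embed Ω P h‖ ^ 2 + ‖H0.op Ω P h‖ ^ 2 := by
  rw [Submodule.coe_norm, WithLp.prod_norm_sq_eq_of_L2]
  rfl

theorem H0.norm_embed_le (P : MvPolynomial (Fin n) ℝ) (h : H0 Ω P) : ‖H0.embed Ω P h‖ ≤ ‖h‖ :=
  le_of_sq_le_sq (by rw [H0.norm_sq_eq]; exact le_add_of_nonneg_right (sq_nonneg _))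
    (norm_nonneg h)

theorem H0.norm_op_le (P : MvPolynomial (Fin n) ℝ) (h : H0 Ω P) : ‖H0.op Ω P h‖ ≤ ‖h‖ :=
  le_of_sq_le_sq (by rw [H0.norm_sq_eq]; exact le_add_of_nonneg_left (sq_nonneg _))
    (norm_nonneg h)

theorem H0.exists_norm_embed_le (hΩ : Bornology.IsBounded (Ω : Set ℝⁿ))
    {P : MvPolynomial (Fin n) ℝ} (hP : Tendsto (symbolTilde P) (cocompact ℝⁿ) atTop) {ε : ℝ}
    (hε : 0 < ε) : ∃ (N : ℕ) (l : H0 Ω P →L[ℂ] (Fin N → ℂ)),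
      ∀ h, ‖H0.embed Ω P h‖ ≤ ε * ‖h‖ + ‖l h‖ := by
  obtain ⟨N, l, hl⟩ := exists_norm_toL2_le hΩ hP (half_pos hε)
  refine ⟨N, l ∘L H0.embed Ω P, fun h => ?_⟩
  have hbound : ‖H0.embed Ω P h‖ ≤
      ε / 2 * (‖H0.embed Ω P h‖ + ‖H0.op Ω P h‖) + ‖l (H0.embed Ω P h)‖ := by
    induction h using (H0.denseRange_ofTest P).induction_on with
    | hp => exact isClosed_le (by fun_prop) (by fun_prop)
    | ih φ =>
      rw [H0.embed_ofTest, H0.op_ofTest]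
      exact hl _ φ.tsupport_subset
  calc ‖H0.embed Ω P h‖
      ≤ ε / 2 * (‖h‖ + ‖h‖) + ‖l (H0.embed Ω P h)‖ := by
        refine hbound.trans ?_
        gcongr
        exacts [H0.norm_embed_le P h, H0.norm_op_le P h]
    _ = ε * ‖h‖ + ‖(l ∘L H0.embed Ω P) h‖ := by
        rw [ContinuousLinearMap.comp_apply]
        ring

theorem H0.isCompactOperator_embed (hΩ : Bornology.IsBounded (Ω : Set ℝⁿ))
    {P : MvPolynomial (Fin n) ℝ} (hP : Tendsto (symbolTilde P) (cocompact ℝⁿ) atTop) :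
    IsCompactOperator (H0.embed Ω P) :=
  isCompactOperator_of_forall_norm_le _ fun _ => H0.exists_norm_embed_le hΩ hP

theorem re_inner_opD_self_nonneg {Q : MvPolynomial (Fin n) ℝ} (hQ : ∀ ξ, 0 ≤ symbol Q ξ)
    (f : 𝓢(ℝⁿ, ℂ)) : 0 ≤ (inner ℂ (toL2 (opD Q f)) (toL2 f)).re := by
  have heq : inner ℂ (toL2 (opD Q f)) (toL2 f) =
      ((∫ ξ, symbol Q ((2 * π) • ξ) * ‖𝓕 f ξ‖ ^ 2 : ℝ) : ℂ) := by
    rw [inner_opD_left, ← inner_toL2_fourier, inner_toL2, ← integral_complex_ofReal]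
    refine integral_congr_ae (ae_of_all _ fun ξ => ?_)
    simp only [fourier_opD, multiplier, RCLike.inner_apply]
    rw [mul_assoc, Complex.mul_conj, Complex.normSq_eq_norm_sq, Complex.ofReal_mul]
  rw [heq, Complex.ofReal_re]
  exact integral_nonneg fun ξ => mul_nonneg (hQ _) (by positivity)

theorem inner_opD_C_self (C : ℝ) (f : 𝓢(ℝⁿ, ℂ)) :
    inner ℂ (toL2 (opD (MvPolynomial.C C) f)) (toL2 f) = ((C * ‖toL2 f‖ ^ 2 : ℝ) : ℂ) := by
  rw [opD_C, map_smul, inner_smul_left, Complex.conj_ofReal, inner_self_eq_norm_sq_to_K]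
  rw [Complex.ofReal_mul, Complex.ofReal_pow]
  rfl

theorem le_re_inner_opD_self {P : MvPolynomial (Fin n) ℝ} {C : ℝ} (hC : ∀ ξ, C ≤ symbol P ξ)
    (f : 𝓢(ℝⁿ, ℂ)) : C * ‖toL2 f‖ ^ 2 ≤ (inner ℂ (toL2 (opD P f)) (toL2 f)).re := by
  have hnonneg := re_inner_opD_self_nonneg (Q := P - MvPolynomial.C C)
    (fun ξ => by simpa [symbol] using hC ξ) f
  rw [map_sub, sub_apply, map_sub, inner_sub_left, inner_opD_C_self, Complex.sub_re,
    Complex.ofReal_re] at hnonneg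
  linarith

theorem re_inner_opD_self_le {P : MvPolynomial (Fin n) ℝ} {C : ℝ} (hC : ∀ ξ, symbol P ξ ≤ C)
    (f : 𝓢(ℝⁿ, ℂ)) : (inner ℂ (toL2 (opD P f)) (toL2 f)).re ≤ C * ‖toL2 f‖ ^ 2 := by
  have hneg := le_re_inner_opD_self (P := -P) (C := -C)
    (fun ξ => by simpa [symbol] using hC ξ) f
  rw [map_neg, neg_apply, map_neg, inner_neg_left, Complex.neg_re] at hneg
  linarith

theorem H0.le_re_inner_op_embed {P : MvPolynomial (Fin n) ℝ} {C : ℝ} (hC : ∀ ξ, C ≤ symbol P ξ)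
    (h : H0 Ω P) :
    C * ‖H0.embed Ω P h‖ ^ 2 ≤ (inner ℂ (H0.op Ω P h) (H0.embed Ω P h)).re := by
  induction h using (H0.denseRange_ofTest P).induction_on with
  | hp => exact isClosed_le (by fun_prop) (by fun_prop)
  | ih φ =>
    rw [H0.embed_ofTest, H0.op_ofTest]
    exact le_re_inner_opD_self hC _

theorem H0.re_inner_op_embed_le {P : MvPolynomial (Fin n) ℝ} {C : ℝ} (hC : ∀ ξ, symbol P ξ ≤ C)
    (h : H0 Ω P) :
    (inner ℂ (H0.op Ω P h) (H0.embed Ω P h)).re ≤ C * ‖H0.embed Ω P h‖ ^ 2 := by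
  induction h using (H0.denseRange_ofTest P).induction_on with
  | hp => exact isClosed_le (by fun_prop) (by fun_prop)
  | ih φ =>
    rw [H0.embed_ofTest, H0.op_ofTest]
    exact re_inner_opD_self_le hC _

theorem tendsto_toL2_of_tendsto_eLpNorm {u : ℝⁿ → ℂ}
    (hu : MemLp ((Ω : Set ℝⁿ).indicator u) 2 volume) {φ : ℕ → 𝓓(Ω, ℂ)}
    (hφ : Tendsto (fun k => eLpNorm (⇑(φ k) - u) 2 (volume.restrict (Ω : Set ℝⁿ))) atTop (𝓝 0)) :
    Tendsto (fun k => toL2 (toSchwartz (φ k))) atTop (𝓝 (hu.toLp _)) := by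
  rw [tendsto_iff_edist_tendsto_0]
  refine hφ.congr fun k => ?_
  rw [← eLpNorm_indicator_eq_eLpNorm_restrict Ω.isOpen.measurableSet, Lp.edist_def]
  refine eLpNorm_congr_ae ?_
  filter_upwards [coeFn_toL2 (toSchwartz (φ k)), hu.coeFn_toLp] with x hφx hux
  have hφ_ind : (Ω : Set ℝⁿ).indicator (φ k) x = φ k x := by
    rw [Set.indicator_eq_self.2 ((subset_tsupport _).trans (φ k).tsupport_subset)]
  rw [Pi.sub_apply, hφx, hux, coe_toSchwartz, ← hφ_ind, ← Pi.sub_apply, ← Set.indicator_sub']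

theorem cauchySeq_toL2_opD {P : MvPolynomial (Fin n) ℝ} {φ : ℕ → 𝓓(Ω, ℂ)}
    (hφ : Tendsto (fun p : ℕ × ℕ => eLpNorm (diffOp P (φ p.1) - diffOp P (φ p.2)) 2 volume)
      atTop (𝓝 0)) : CauchySeq fun k => toL2 (opD P (toSchwartz (φ k))) := by
  rw [EMetric.cauchySeq_iff]
  intro ε hε
  obtain ⟨N, hN⟩ := eventually_atTop_prod_self'.1 (hφ.eventually (gt_mem_nhds hε))
  refine ⟨N, fun k hk l hl => (hN k hk l hl).trans_eq' ?_⟩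
  rw [Lp.edist_def, diffOp_testFunction, diffOp_testFunction]
  refine eLpNorm_congr_ae ?_
  filter_upwards [coeFn_toL2 (opD P (toSchwartz (φ k))), coeFn_toL2 (opD P (toSchwartz (φ l)))]
    with x hk hl
  rw [Pi.sub_apply, Pi.sub_apply, hk, hl]

theorem MemH0.exists_embed_ae_eq {P : MvPolynomial (Fin n) ℝ} {u : ℝⁿ → ℂ} (hu : MemH0 Ω P u) :
    ∃ h : H0 Ω P, H0.embed Ω P h =ᵐ[volume.restrict (Ω : Set ℝⁿ)] u := by
  obtain ⟨hu_mem, φ, hcauchy, hlim⟩ := hu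
  have hu_ind : MemLp ((Ω : Set ℝⁿ).indicator u) 2 volume :=
    (memLp_indicator_iff_restrict Ω.isOpen.measurableSet).2 hu_mem
  obtain ⟨F, hF⟩ := cauchySeq_tendsto_of_complete (cauchySeq_toL2_opD hcauchy)
  have hmem : WithLp.toLp 2 (hu_ind.toLp _, F) ∈ H0 Ω P :=
    mem_closure_of_tendsto (f := fun k => graphMap Ω P (φ k))
      (((WithLp.prod_continuous_toLp 2 _ _).tendsto _).comp
        ((tendsto_toL2_of_tendsto_eLpNorm hu_ind hlim).prodMk_nhds hF))
      (Eventually.of_forall fun k => ⟨φ k, rfl⟩)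
  have hembed : H0.embed Ω P ⟨_, hmem⟩ =ᵐ[volume] (Ω : Set ℝⁿ).indicator u := hu_ind.coeFn_toLp
  exact ⟨⟨_, hmem⟩, hembed.restrict.trans (indicator_ae_eq_restrict Ω.isOpen.measurableSet)⟩

end MinimalDomain

section Reciprocal

variable {α : Type*} {m : MeasurableSpace α} {μ : Measure α}

theorem memLp_top_inv {f : α → ℝ} {δ : ℝ} (hδ : 0 < δ) (hf : AEMeasurable f μ)
    (hfδ : ∀ᵐ x ∂μ, δ ≤ f x) : MemLp (fun x => (f x)⁻¹) ∞ μ := by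
  refine memLp_top_of_bound hf.inv.aestronglyMeasurable δ⁻¹ ?_
  filter_upwards [hfδ] with x hx
  rw [norm_inv]
  exact inv_anti₀ hδ (hx.trans (Real.le_norm_self _))

theorem exists_pos_le_inv {f : α → ℝ} (hf : MemLp f ∞ μ) (hf_pos : ∀ᵐ x ∂μ, 0 < f x) :
    ∃ c > 0, ∀ᵐ x ∂μ, c ≤ (f x)⁻¹ := by
  refine ⟨(lpNorm f ∞ μ + 1)⁻¹, inv_pos.2 (add_pos_of_nonneg_of_pos lpNorm_nonneg one_pos), ?_⟩
  filter_upwards [hf_pos, ae_le_lpNorm_exponent_top hf] with x hpos hle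
  exact inv_anti₀ hpos <|
    (Real.le_norm_self _).trans (hle.trans (le_add_of_nonneg_right zero_le_one))

theorem exists_reciprocal {s : Set α} (hs : MeasurableSet s) {f : α → ℝ}
    (hf : MemLp f ∞ (μ.restrict s)) {δ : ℝ} (hδ : 0 < δ) (hfδ : ∀ᵐ x ∂μ.restrict s, δ ≤ f x) :
    ∃ (r : α → ℝ) (c : ℝ), 0 < c ∧ MemLp r ∞ μ ∧ (∀ᵐ x ∂μ, c ≤ r x) ∧
      ∀ᵐ x ∂μ.restrict s, r x * f x = 1 := by
  classical
  set F : α → ℝ := s.piecewise f 1 with hF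
  have hF_mem : MemLp F ∞ μ := hf.piecewise hs (memLp_top_const 1)
  have hF_eq : F =ᵐ[μ.restrict s] f := piecewise_ae_eq_restrict hs
  have hF_lower : ∀ᵐ x ∂μ, min δ 1 ≤ F x := by
    filter_upwards [(ae_restrict_iff' hs).1 hfδ] with x hx
    by_cases hxs : x ∈ s
    · rw [hF, Set.piecewise_eq_of_mem _ _ _ hxs]
      exact min_le_of_left_le (hx hxs)
    · rw [hF, Set.piecewise_eq_of_notMem _ _ _ hxs]
      exact min_le_right _ _
  have hmin : 0 < min δ 1 := lt_min hδ one_pos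
  obtain ⟨c, hc, hcF⟩ := exists_pos_le_inv hF_mem (hF_lower.mono fun _ hx => hmin.trans_le hx)
  refine ⟨fun x => (F x)⁻¹, c, hc, memLp_top_inv hmin hF_mem.1.aemeasurable hF_lower, hcF, ?_⟩
  filter_upwards [hF_eq, hfδ] with x hx hδx
  rw [hx, inv_mul_cancel₀ (hδ.trans_le hδx).ne']

end Reciprocal

section Reduction

open SchwartzMap LineDeriv
open scoped SchwartzMap ComplexConjugate ContDiff

variable {n : ℕ} {Ω : Opens (EuclideanSpace ℝ (Fin n))}

local notation "ℝⁿ" => EuclideanSpace ℝ (Fin n)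

/-- Pointwise complex conjugation of Schwartz functions. -/
noncomputable def conjSchwartz : 𝓢(ℝⁿ, ℂ) →L[ℝ] 𝓢(ℝⁿ, ℂ) :=
  postcompCLM (Complex.conjCLE : ℂ →L[ℝ] ℂ)

theorem conjSchwartz_apply (f : 𝓢(ℝⁿ, ℂ)) (x : ℝⁿ) : conjSchwartz f x = conj (f x) := rfl

theorem conjSchwartz_smul (c : ℂ) (f : 𝓢(ℝⁿ, ℂ)) :
    conjSchwartz (c • f) = conj c • conjSchwartz f :=
  SchwartzMap.ext fun x => map_mul (starRingEnd ℂ) c (f x)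

theorem lineDerivOp_conjSchwartz (y : ℝⁿ) (f : 𝓢(ℝⁿ, ℂ)) :
    ∂_{y} (conjSchwartz f) = conjSchwartz (∂_{y} f) := by
  ext x
  have hderiv : HasFDerivAt (conjSchwartz f) ((Complex.conjCLE : ℂ →L[ℝ] ℂ) ∘L fderiv ℝ f x) x :=
    (Complex.conjCLE : ℂ →L[ℝ] ℂ).hasFDerivAt.comp x (f.hasFDerivAt x)
  rw [conjSchwartz_apply, lineDerivOp_apply_eq_fderiv, lineDerivOp_apply_eq_fderiv, hderiv.fderiv]
  rfl

theorem opD_X_conjSchwartz (j : Fin n) (f : 𝓢(ℝⁿ, ℂ)) :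
    opD (MvPolynomial.X j) (conjSchwartz f) = -conjSchwartz (opD (MvPolynomial.X j) f) := by
  rw [opD_X, opD_X, lineDerivOp_conjSchwartz, conjSchwartz_smul, map_neg, Complex.conj_I, neg_neg,
    neg_smul]

theorem opD_reflect_conjSchwartz (Q : MvPolynomial (Fin n) ℝ) (f : 𝓢(ℝⁿ, ℂ)) :
    opD (reflect Q) (conjSchwartz f) = conjSchwartz (opD Q f) := by
  induction Q using MvPolynomial.induction_on generalizing f with
  | C a =>
    rw [reflect, MvPolynomial.aeval_C, MvPolynomial.algebraMap_eq, opD_C, opD_C, conjSchwartz_smul,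
      Complex.conj_ofReal]
  | add p q hp hq =>
    have hadd : reflect (p + q) = reflect p + reflect q := map_add _ _ _
    rw [hadd, map_add, map_add, add_apply, add_apply, hp, hq, map_add]
  | mul_X p j hp =>
    have hmul : reflect (p * MvPolynomial.X j) = reflect p * -MvPolynomial.X j := by
      simp only [reflect, map_mul, MvPolynomial.aeval_X]
    rw [hmul, opD_mul_apply, map_neg, neg_apply, opD_X_conjSchwartz, neg_neg, hp, opD_mul_apply]

/-- Pointwise complex conjugation of test functions, which turns the bilinear pairing in
`WeakSolution` into a sesquilinear one. -/
noncomputable def conjTest (ψ : 𝓓(Ω, ℂ)) : 𝓓(Ω, ℂ) where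
  toFun x := conj (ψ x)
  contDiff' := Complex.conjCLE.contDiff.comp ψ.contDiff
  hasCompactSupport' := ψ.hasCompactSupport.comp_left (map_zero _)
  tsupport_subset' := (closure_mono (Function.support_comp_subset (map_zero _) ψ)).trans
    ψ.tsupport_subset

theorem conjTest_apply (ψ : 𝓓(Ω, ℂ)) (x : ℝⁿ) : conjTest ψ x = conj (ψ x) := rfl

theorem toSchwartz_conjTest (ψ : 𝓓(Ω, ℂ)) :
    toSchwartz (conjTest ψ) = conjSchwartz (toSchwartz ψ) := rfl

/-- The operator `P(D) - z` on Schwartz functions. -/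
noncomputable def shiftedOp (P : MvPolynomial (Fin n) ℝ) (z : ℂ) : 𝓢(ℝⁿ, ℂ) →L[ℂ] 𝓢(ℝⁿ, ℂ) :=
  opD P - z • ContinuousLinearMap.id ℂ _

theorem shiftedOp_apply (P : MvPolynomial (Fin n) ℝ) (z : ℂ) (f : 𝓢(ℝⁿ, ℂ)) :
    shiftedOp P z f = opD P f - z • f := rfl

theorem tsupport_shiftedOp_subset (P : MvPolynomial (Fin n) ℝ) (z : ℂ) (f : 𝓢(ℝⁿ, ℂ)) :
    tsupport (shiftedOp P z f) ⊆ tsupport f :=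
  (tsupport_sub _ _).trans
    (Set.union_subset (tsupport_opD_subset P f) (tsupport_smul_subset_right (fun _ => z) f))

theorem conj_shiftedOp_apply (P : MvPolynomial (Fin n) ℝ) (z : ℂ) (ψ : 𝓓(Ω, ℂ)) (x : ℝⁿ) :
    conj (shiftedOp P (conj z) (toSchwartz ψ) x) =
      diffOp (reflect P) (conjTest ψ) x - z * conj (ψ x) := by
  rw [diffOp_testFunction, toSchwartz_conjTest, opD_reflect_conjSchwartz, conjSchwartz_apply,
    shiftedOp_apply, sub_apply, smul_apply, coe_toSchwartz, smul_eq_mul,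
    map_sub, map_mul, Complex.conj_conj]

theorem MemL2Loc.bounded_mul {f q : ℝⁿ → ℂ} (hf : MemL2Loc Ω f)
    (hq : MemLp q ∞ (volume.restrict (Ω : Set ℝⁿ))) : MemL2Loc Ω fun x => q x * f x :=
  fun K hK hKΩ => (hf K hK hKΩ).mul (hq.mono_measure (Measure.restrict_mono hKΩ le_rfl))

theorem MemL2Loc.locallyIntegrableOn {f : ℝⁿ → ℂ} (hf : MemL2Loc Ω f) :
    LocallyIntegrableOn f (Ω : Set ℝⁿ) := by
  rw [locallyIntegrableOn_iff Ω.isOpen.isLocallyClosed]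
  intro K hKΩ hK
  have : IsFiniteMeasure (volume.restrict K) := isFiniteMeasure_restrict.2 hK.measure_ne_top
  exact (hf K hK hKΩ).integrable one_le_two

theorem MemL2Loc.integrableOn_mul_conj {f : ℝⁿ → ℂ} (hf : MemL2Loc Ω f) {g : 𝓢(ℝⁿ, ℂ)}
    (hg : HasCompactSupport g) (hgΩ : tsupport g ⊆ Ω) :
    IntegrableOn (fun x => f x * conj (g x)) (Ω : Set ℝⁿ) := by
  have hint : IntegrableOn (fun x => f x * conj (g x)) (tsupport g) :=
    (hf _ hg hgΩ).integrable_mul (((conjSchwartz g).memLp 2 volume).restrict _)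
  refine hint.of_forall_sdiff_eq_zero Ω.isOpen.measurableSet fun x hx => ?_
  rw [image_eq_zero_of_notMem_tsupport hx.2, map_zero, mul_zero]

theorem MemL2Loc.integrableOn_mul_conj_test {f : ℝⁿ → ℂ} (hf : MemL2Loc Ω f) (ψ : 𝓓(Ω, ℂ)) :
    IntegrableOn (fun x => f x * conj (ψ x)) (Ω : Set ℝⁿ) :=
  hf.integrableOn_mul_conj (g := toSchwartz ψ) ψ.hasCompactSupport ψ.tsupport_subset

theorem WeakSolution.setIntegral_mul_conj_shiftedOp {P : MvPolynomial (Fin n) ℝ} {q f : ℝⁿ → ℂ}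
    {z : ℂ} (hsol : WeakSolution Ω P (fun x => q x - z) f) (hf : MemL2Loc Ω f)
    (hq : MemLp q ∞ (volume.restrict (Ω : Set ℝⁿ))) (ψ : 𝓓(Ω, ℂ)) :
    ∫ x in (Ω : Set ℝⁿ), f x * conj (shiftedOp P (conj z) (toSchwartz ψ) x) =
      -∫ x in (Ω : Set ℝⁿ), q x * f x * conj (ψ x) := by
  have hsupp := tsupport_shiftedOp_subset P (conj z) (toSchwartz ψ)
  rw [← add_eq_zero_iff_eq_neg, ← integral_add
    (hf.integrableOn_mul_conj (ψ.hasCompactSupport.mono' (subset_closure.trans hsupp))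
      (hsupp.trans ψ.tsupport_subset))
    ((hf.bounded_mul hq).integrableOn_mul_conj_test ψ), ← hsol (conjTest ψ)]
  refine integral_congr_ae (ae_of_all _ fun x => ?_)
  simp only [conj_shiftedOp_apply, conjTest_apply]
  ring

theorem WeakSolution.setIntegral_mul_conj_shiftedOp_eq_zero {P : MvPolynomial (Fin n) ℝ}
    {f : ℝⁿ → ℂ} {z : ℂ} (hsol : WeakSolution Ω P (fun _ => -z) f) (hf : MemL2Loc Ω f)
    (ψ : 𝓓(Ω, ℂ)) :
    ∫ x in (Ω : Set ℝⁿ), f x * conj (shiftedOp P (conj z) (toSchwartz ψ) x) = 0 := by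
  rw [WeakSolution.setIntegral_mul_conj_shiftedOp (q := 0)
    (by simpa only [Pi.zero_apply, zero_sub] using hsol) hf MemLp.zero ψ]
  simp

theorem inner_toL2_eq_setIntegral {g : 𝓢(ℝⁿ, ℂ)} (hg : tsupport g ⊆ Ω)
    {U : ℝⁿ →₂[volume] ℂ} {F : ℝⁿ → ℂ} (hU : U =ᵐ[volume.restrict (Ω : Set ℝⁿ)] F) :
    inner ℂ (toL2 g) U = ∫ x in (Ω : Set ℝⁿ), F x * conj (g x) := by
  calc inner ℂ (toL2 g) U = ∫ x, U x * conj (g x) := by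
        rw [MeasureTheory.L2.inner_def]
        refine integral_congr_ae ?_
        filter_upwards [coeFn_toL2 g] with x hx
        rw [hx, RCLike.inner_apply]
    _ = ∫ x in (Ω : Set ℝⁿ), U x * conj (g x) :=
        (setIntegral_eq_integral_of_forall_compl_eq_zero fun x hx => by
          rw [image_eq_zero_of_notMem_tsupport fun h => hx (hg h), map_zero, mul_zero]).symm
    _ = ∫ x in (Ω : Set ℝⁿ), F x * conj (g x) :=
        integral_congr_ae (hU.mono fun x hx => by simp only [hx])

theorem inner_shiftedOp_embed (P : MvPolynomial (Fin n) ℝ) (z : ℂ) (ψ : 𝓓(Ω, ℂ)) (h : H0 Ω P) :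
    inner ℂ (toL2 (shiftedOp P (conj z) (toSchwartz ψ))) (H0.embed Ω P h) =
      inner ℂ (toL2 (toSchwartz ψ)) (H0.op Ω P h - z • H0.embed Ω P h) := by
  induction h using (H0.denseRange_ofTest P).induction_on with
  | hp => exact isClosed_eq (by fun_prop) (by fun_prop)
  | ih φ =>
    rw [H0.embed_ofTest, H0.op_ofTest, shiftedOp_apply, map_sub, map_smul, inner_sub_left,
      inner_sub_right, inner_smul_left, inner_smul_right, inner_opD_left, Complex.conj_conj]

/-- A real-valued smooth function with compact support in `Ω` as a complex test function. -/
noncomputable def ofRealTest {g : ℝⁿ → ℝ} (hg : ContDiff ℝ ∞ g) (hg_compact : HasCompactSupport g)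
    (hgΩ : tsupport g ⊆ Ω) : 𝓓(Ω, ℂ) where
  toFun x := (g x : ℂ)
  contDiff' := Complex.ofRealCLM.contDiff.comp hg
  hasCompactSupport' := hg_compact.comp_left Complex.ofReal_zero
  tsupport_subset' := (closure_mono
    (Function.support_comp_subset Complex.ofReal_zero g)).trans hgΩ

theorem MemL2Loc.ae_eq_of_forall_setIntegral_eq {f g : ℝⁿ → ℂ} (hf : MemL2Loc Ω f)
    (hg : MemL2Loc Ω g) (h : ∀ ψ : 𝓓(Ω, ℂ), ∫ x in (Ω : Set ℝⁿ), f x * conj (ψ x) =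
      ∫ x in (Ω : Set ℝⁿ), g x * conj (ψ x)) : f =ᵐ[volume.restrict (Ω : Set ℝⁿ)] g := by
  have hzero : ∀ᵐ x, x ∈ Ω → (f - g) x = 0 := by
    refine Ω.isOpen.ae_eq_zero_of_integral_contDiff_smul_eq_zero
      (hf.locallyIntegrableOn.sub hg.locallyIntegrableOn) fun φ hφ hφ_compact hφΩ => ?_
    set ψ : 𝓓(Ω, ℂ) := ofRealTest hφ hφ_compact hφΩ
    calc ∫ x, φ x • (f - g) x = ∫ x in (Ω : Set ℝⁿ), φ x • (f - g) x :=
          (setIntegral_eq_integral_of_forall_compl_eq_zero fun x hx => by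
            rw [image_eq_zero_of_notMem_tsupport fun h => hx (hφΩ h), zero_smul]).symm
      _ = ∫ x in (Ω : Set ℝⁿ), (f x * conj (ψ x) - g x * conj (ψ x)) := by
          refine integral_congr_ae (ae_of_all _ fun x => ?_)
          have hψ : conj (ψ x) = (φ x : ℂ) := Complex.conj_ofReal _
          simp only [hψ, Pi.sub_apply, Complex.real_smul]
          ring
      _ = 0 := by
          rw [integral_sub (hf.integrableOn_mul_conj_test ψ) (hg.integrableOn_mul_conj_test ψ), h ψ,
            sub_self]
  filter_upwards [ae_restrict_of_ae hzero, ae_restrict_mem Ω.isOpen.measurableSet] with x hx hxΩ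
  exact sub_eq_zero.1 (hx hxΩ)

theorem inner_shiftedOp_eq_setIntegral {P : MvPolynomial (Fin n) ℝ} {q v w : ℝⁿ → ℂ} {z : ℂ}
    (hq : MemLp q ∞ (volume.restrict (Ω : Set ℝⁿ))) (hv : MemL2Loc Ω v) (hw : MemL2Loc Ω w)
    (hv_sol : WeakSolution Ω P (fun _ => -z) v) (hw_sol : WeakSolution Ω P (fun x => q x - z) w)
    {U : ℝⁿ →₂[volume] ℂ} (hU : U =ᵐ[volume.restrict (Ω : Set ℝⁿ)] v - w) (ψ : 𝓓(Ω, ℂ)) :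
    inner ℂ (toL2 (shiftedOp P (conj z) (toSchwartz ψ))) U =
      ∫ x in (Ω : Set ℝⁿ), q x * w x * conj (ψ x) := by
  set g := shiftedOp P (conj z) (toSchwartz ψ)
  have hsupp : tsupport g ⊆ tsupport ψ := tsupport_shiftedOp_subset P (conj z) (toSchwartz ψ)
  have hg : HasCompactSupport g := ψ.hasCompactSupport.mono' (subset_closure.trans hsupp)
  have hgΩ : tsupport g ⊆ Ω := hsupp.trans ψ.tsupport_subset
  calc inner ℂ (toL2 g) U = ∫ x in (Ω : Set ℝⁿ), (v x * conj (g x) - w x * conj (g x)) := by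
        rw [inner_toL2_eq_setIntegral hgΩ hU]
        simp only [Pi.sub_apply, sub_mul]
    _ = ∫ x in (Ω : Set ℝⁿ), q x * w x * conj (ψ x) := by
        rw [integral_sub (hv.integrableOn_mul_conj hg hgΩ) (hw.integrableOn_mul_conj hg hgΩ),
          hv_sol.setIntegral_mul_conj_shiftedOp_eq_zero hv,
          hw_sol.setIntegral_mul_conj_shiftedOp hw hq, zero_sub, neg_neg]

theorem H0.op_sub_smul_embed_ae_eq {P : MvPolynomial (Fin n) ℝ} {z : ℂ} {h : H0 Ω P}
    {g : ℝⁿ → ℂ} (hg : MemL2Loc Ω g)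
    (hweak : ∀ ψ : 𝓓(Ω, ℂ), inner ℂ (toL2 (shiftedOp P (conj z) (toSchwartz ψ))) (H0.embed Ω P h) =
      ∫ x in (Ω : Set ℝⁿ), g x * conj (ψ x)) :
    (H0.op Ω P h - z • H0.embed Ω P h : ℝⁿ →₂[volume] ℂ) =ᵐ[volume.restrict (Ω : Set ℝⁿ)] g := by
  refine MemL2Loc.ae_eq_of_forall_setIntegral_eq (fun K _ _ => (Lp.memLp _).restrict K) hg
    fun ψ => ?_
  rw [← hweak ψ, inner_shiftedOp_embed]
  exact (inner_toL2_eq_setIntegral (g := toSchwartz ψ) ψ.tsupport_subset .rfl).symm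

theorem H0.inner_op_sub_smul_embed_eq_zero {P : MvPolynomial (Fin n) ℝ} {z : ℂ}
    {F : ℝⁿ →₂[volume] ℂ}
    (hF : ∀ ψ : 𝓓(Ω, ℂ), inner ℂ (toL2 (shiftedOp P z (toSchwartz ψ))) F = 0) (k : H0 Ω P) :
    inner ℂ (H0.op Ω P k - z • H0.embed Ω P k) F = 0 := by
  induction k using (H0.denseRange_ofTest P).induction_on with
  | hp => exact isClosed_eq (by fun_prop) (by fun_prop)
  | ih ψ => rw [H0.op_ofTest, H0.embed_ofTest, ← hF ψ, shiftedOp_apply, map_sub, map_smul]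

theorem exists_degenerate_of_isTransmissionEigenvalue {P : MvPolynomial (Fin n) ℝ} {V r : ℝⁿ → ℝ}
    (hV : MemLp V ∞ (volume.restrict (Ω : Set ℝⁿ))) (hr : MemLp (fun x => (r x : ℂ)) ∞ volume)
    (hrV : ∀ᵐ x ∂volume.restrict (Ω : Set ℝⁿ), r x * V x = 1) {z : ℂ}
    (hz : IsTransmissionEigenvalue Ω P V z) :
    ∃ h ≠ 0, ∀ k, transmissionForm (H0.op Ω P) (H0.embed Ω P) (mulL2 hr) z k h = 0 := by
  obtain ⟨v, w, hv, hw, -, hw_ne, hv_sol, hw_sol, hu⟩ := hz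
  obtain ⟨h, hh⟩ := hu.exists_embed_ae_eq
  have hweak := inner_shiftedOp_eq_setIntegral hV.ofReal hv hw hv_sol hw_sol hh
  have hrw : mulL2 hr (H0.op Ω P h - z • H0.embed Ω P h) =ᵐ[volume.restrict (Ω : Set ℝⁿ)] w := by
    filter_upwards [ae_restrict_of_ae (coeFn_mulL2 hr _), hrV,
      H0.op_sub_smul_embed_ae_eq (hw.bounded_mul hV.ofReal) hweak] with x hx hrVx hVw
    rw [hx, hVw, ← mul_assoc, RCLike.ofReal_eq_complex_ofReal, ← Complex.ofReal_mul, hrVx,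
      Complex.ofReal_one, one_mul]
  have hv_eq : (mulL2 hr (H0.op Ω P h - z • H0.embed Ω P h) + H0.embed Ω P h : ℝⁿ →₂[volume] ℂ)
      =ᵐ[volume.restrict (Ω : Set ℝⁿ)] v := by
    filter_upwards [ae_restrict_of_ae (Lp.coeFn_add _ (H0.embed Ω P h)), hrw, hh] with x hx hwx hux
    rw [hx, Pi.add_apply, hwx, hux, Pi.sub_apply, add_sub_cancel]
  refine ⟨h, ?_, fun k => ?_⟩
  · rintro rfl
    rw [map_zero, map_zero, smul_zero, sub_zero, map_zero] at hrw
    exact hw_ne (hrw.symm.trans (ae_restrict_of_ae (Lp.coeFn_zero ℂ 2 volume)))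
  · refine H0.inner_op_sub_smul_embed_eq_zero (fun ψ => ?_) k
    have hsupp := (tsupport_shiftedOp_subset P (conj z) (toSchwartz ψ)).trans ψ.tsupport_subset
    exact (inner_toL2_eq_setIntegral hsupp hv_eq).trans
      (hv_sol.setIntegral_mul_conj_shiftedOp_eq_zero hv ψ)

end Reduction

end ITP

theorem theorem3p3_general {n : ℕ} (Ω : Opens (EuclideanSpace ℝ (Fin n)))
    (hΩ_bdd : Bornology.IsBounded (Ω : Set (EuclideanSpace ℝ (Fin n))))
    (V : EuclideanSpace ℝ (Fin n) → ℝ)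
    (hV : MemLp V ∞ (volume.restrict (Ω : Set (EuclideanSpace ℝ (Fin n)))))
    (δ : ℝ) (hδ : 0 < δ)
    (hV_lower : ∀ᵐ x ∂(volume.restrict (Ω : Set (EuclideanSpace ℝ (Fin n)))), δ ≤ V x)
    (P : MvPolynomial (Fin n) ℝ)
    (hP_tilde : Tendsto (ITP.symbolTilde P) (cocompact (EuclideanSpace ℝ (Fin n))) atTop)
    (hP_below : (∃ C : ℝ, ∀ ξ, C ≤ ITP.symbol P ξ) ∨ (∃ C : ℝ, ∀ ξ, C ≤ -ITP.symbol P ξ)) :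
    IsClosed {z : ℂ | ITP.IsTransmissionEigenvalue Ω P V z} ∧
      IsDiscrete {z : ℂ | ITP.IsTransmissionEigenvalue Ω P V z} := by
  obtain ⟨r, c, hc, hr, hrc, hrV⟩ :=
    ITP.exists_reciprocal Ω.isOpen.measurableSet hV hδ hV_lower
  refine ITP.isClosed_and_isDiscrete_of_finite_inter_closedBall 0 fun R =>
    (ITP.finite_degenerate_transmissionForm (p := ITP.H0.op Ω P) (j := ITP.H0.embed Ω P)
      (ρ := ITP.mulL2 hr.ofReal) hc (ITP.H0.isCompactOperator_embed hΩ_bdd hP_tilde)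
      (fun h => (ITP.H0.norm_sq_eq P h).le) (ITP.le_re_inner_mulL2 hr.ofReal hrc)
      (hP_below.imp ?_ ?_) R).subset ?_
  · exact fun ⟨C, hC⟩ => ⟨C, ITP.H0.le_re_inner_op_embed hC⟩
  · exact fun ⟨C, hC⟩ => ⟨-C, ITP.H0.re_inner_op_embed_le fun ξ => le_neg_of_le_neg (hC ξ)⟩
  · exact fun z ⟨hz, hzR⟩ => ⟨mem_closedBall_zero_iff.1 hzR,
      ITP.exists_degenerate_of_isTransmissionEigenvalue hV hr.ofReal hrV hz⟩

theorem theorem3p3 {n : ℕ} (Ω : Opens (EuclideanSpace ℝ (Fin n)))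
    (hΩ_conn : IsConnected (Ω : Set (EuclideanSpace ℝ (Fin n))))
    (hΩ_bdd : Bornology.IsBounded (Ω : Set (EuclideanSpace ℝ (Fin n))))
    (V : EuclideanSpace ℝ (Fin n) → ℝ) (hV : MemLp V ∞ volume)
    (hV_supp : ITP.essSupport V = closure (Ω : Set (EuclideanSpace ℝ (Fin n))))
    (δ : ℝ) (hδ : 0 < δ)
    (hV_lower : ∀ᵐ x ∂(volume.restrict (Ω : Set (EuclideanSpace ℝ (Fin n)))), δ ≤ V x)
    (P : MvPolynomial (Fin n) ℝ) (hP_order : 2 ≤ P.totalDegree)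
    (hP_tilde : Tendsto (ITP.symbolTilde P) (cocompact (EuclideanSpace ℝ (Fin n))) atTop)
    (hP_below : (∃ C : ℝ, ∀ ξ, C ≤ ITP.symbol P ξ) ∨ (∃ C : ℝ, ∀ ξ, C ≤ -ITP.symbol P ξ)) :
    IsClosed {z : ℂ | ITP.IsTransmissionEigenvalue Ω P V z} ∧
      IsDiscrete {z : ℂ | ITP.IsTransmissionEigenvalue Ω P V z} :=
  theorem3p3_general Ω hΩ_bdd V (hV.restrict _) δ hδ hV_lower P hP_tilde hP_below
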